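/- A domain is a nonempty connected open set $G\subset\mathbb C^n$; it is $n$-circled if $(e^{i\theta_1}z_1,\dots,e^{i\theta_n}z_n)\in G$ for all $z\in G$ and $\theta\in\mathbb R^n$, and fat if $G=\operatorname{int}\overline G$. Put $\log G:=\{x\in\mathbb R^n:(e^{x_1},\dots,e^{x_n})\in G\}$, and for $X\subset\mathbb R^n$ let $\mathcal E(X)$ be the largest vector subspace $F\subset\mathbb R^n$ with $X+F=X$. Let $\mathcal O(G)$ be the space of holomorphic functions on $G$. For $k\in\mathbb Z_+=\{0,1,2,\dots\}$ let $\mathcal H^{\infty,k}(G)$ be the space of all $f\in\mathcal O(G)$ with $\partial^\nu f\in L^\infty(G)$ for every multi-index $\nu\in\mathbb Z_+^n$ with $|\nu|\le k$, and let $\mathcal A^k(G)$ be the space of all $f\in\mathcal O(G)$ such that for every $|\nu|\le k$ the derivative $\partial^\nu f$ extends to a continuous function on $\overline G$. For $\mathcal F\subset\mathcal O(G)$, a domain $G$ is called an $\mathcal F$-domain of holomorphy if there are no domains $G_0,\widetilde G\subset\mathbb C^n$ with $\varnothing\ne G_0\subset G\cap\widetilde G$ and $\widetilde G\not\subset G$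 such that for each $f\in\mathcal F$ there is $\widetilde f\in\mathcal O(\widetilde G)$ with $\widetilde f=f$ on $G_0$; a domain of holomorphy is an $\mathcal O(G)$-domain of holomorphy. Proposition 7. Let $G\subset\mathbb C^n$ be an $n$-circled domain of holomorphy. Then the following conditions are equivalent: (i) up to a permutation of the coordinates, $G=D\times\mathbb C^{n-m}$, where $0\le m\le n$ and $D\subset\mathbb C^m$ is a fat $m$-circled domain of holomorphy with $\mathcal E(\log D)=\{0\}$; (ii) $G$ is an $\mathcal H^{\infty,1}(G)$-domain of holomorphy; (iii) for every $k\in\mathbb Z_+$, $G$ is an $\mathcal H^{\infty,k}(G)\cap\mathcal A^k(G)$-domain of holomorphy. -/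

import Mathlib

open Set MeasureTheory
open scoped Pointwise ENNReal

/-- A domain in `ℂⁿ`: a nonempty connected open set. -/
def IsCDomain {n : ℕ} (G : Set (Fin n → ℂ)) : Prop :=
  IsOpen G ∧ IsConnected G

/-- `G` is `n`-circled: invariant under `z ↦ (e^{iθ₁} z₁, …, e^{iθₙ} zₙ)` for all real `θ`. -/
def IsNCircled {n : ℕ} (G : Set (Fin n → ℂ)) : Prop :=
  ∀ z ∈ G, ∀ θ : Fin n → ℝ, (fun j => Complex.exp (Complex.I * (θ j : ℂ)) * z j) ∈ G

/-- `log G = {x ∈ ℝⁿ : (e^{x₁}, …, e^{xₙ}) ∈ G}`. -/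
def logSet {n : ℕ} (G : Set (Fin n → ℂ)) : Set (Fin n → ℝ) :=
  {x | (fun j => ((Real.exp (x j) : ℝ) : ℂ)) ∈ G}

/-- `𝓔(X)`: the largest vector subspace `F` of `ℝⁿ` with `X + F = X`. -/
noncomputable def linealitySpace {n : ℕ} (X : Set (Fin n → ℝ)) : Submodule ℝ (Fin n → ℝ) :=
  sSup {F : Submodule ℝ (Fin n → ℝ) | X + (F : Set (Fin n → ℝ)) = X}

/-- The supremum defining `𝓔(X)` is attained, so that `𝓔(X)` is indeed the largest such subspace. -/
theorem linealitySpace_isGreatest {n : ℕ} (X : Set (Fin n → ℝ)) :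
    IsGreatest {F : Submodule ℝ (Fin n → ℝ) | X + (F : Set (Fin n → ℝ)) = X}
      (linealitySpace X) := by
  refine ⟨?_, fun F hF => le_sSup hF⟩
  have key : ∀ v ∈ linealitySpace X, ∀ x ∈ X, x + v ∈ X := by
    intro v hv
    unfold linealitySpace at hv
    rw [sSup_eq_iSup'] at hv
    induction hv using Submodule.iSup_induction' with
    | mem F v hv =>
      intro x hx
      have hF : X + ((F : Submodule ℝ (Fin n → ℝ)) : Set (Fin n → ℝ)) = X := F.2
      exact hF ▸ Set.add_mem_add hx hv
    | zero => intro x hx; simpa using hx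
    | add v w _ _ hv hw =>
      intro x hx
      rw [← add_assoc]
      exact hw _ (hv _ hx)
  apply Set.Subset.antisymm
  · rintro _ ⟨x, hx, v, hv, rfl⟩
    exact key v hv x hx
  · intro x hx
    exact ⟨x, hx, 0, (linealitySpace X).zero_mem, add_zero x⟩

/-- `G` is fat: `G = int (closure G)`. -/
def IsFat {n : ℕ} (G : Set (Fin n → ℂ)) : Prop :=
  G = interior (closure G)

/-- `𝓞(G)`: the functions holomorphic on `G` (their values off `G` are irrelevant). -/
def holo {n : ℕ} (G : Set (Fin n → ℂ)) : Set ((Fin n → ℂ) → ℂ) :=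
  {f | DifferentiableOn ℂ f G}

/-- `G` is an `𝓕`-domain of holomorphy: it is a domain, and there are no domains `G₀`, `G₁` with
`∅ ≠ G₀ ⊆ G ∩ G₁` and `G₁ ⊄ G` such that every `f ∈ 𝓕` agrees on `G₀` with a function
holomorphic on `G₁`. -/
def IsDomainOfHolomorphyFor {n : ℕ} (𝓕 : Set ((Fin n → ℂ) → ℂ)) (G : Set (Fin n → ℂ)) : Prop :=
  IsCDomain G ∧
    ¬ ∃ G₀ G₁ : Set (Fin n → ℂ), IsCDomain G₀ ∧ IsCDomain G₁ ∧ G₀ ⊆ G ∩ G₁ ∧ ¬ G₁ ⊆ G ∧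
      ∀ f ∈ 𝓕, ∃ g ∈ holo G₁, EqOn g f G₀

/-- `G` is a domain of holomorphy, i.e. an `𝓞(G)`-domain of holomorphy. -/
def IsDomainOfHolomorphy {n : ℕ} (G : Set (Fin n → ℂ)) : Prop :=
  IsDomainOfHolomorphyFor (holo G) G

/-- The complex partial derivative `∂f/∂z_j`. -/
noncomputable def cpartial {n : ℕ} (j : Fin n) (f : (Fin n → ℂ) → ℂ) : (Fin n → ℂ) → ℂ :=
  fun z => fderiv ℂ f z (Pi.single j 1)

/-- `∂^ν f = ∂₁^{ν₁} ⋯ ∂ₙ^{νₙ} f` for a multi-index `ν`. -/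
noncomputable def multiPartial {n : ℕ} (ν : Fin n → ℕ) (f : (Fin n → ℂ) → ℂ) :
    (Fin n → ℂ) → ℂ :=
  (List.finRange n).foldr (fun j g => (cpartial j)^[ν j] g) f

/-- `L_h^{p,k}(G)`: holomorphic functions on `G` all of whose derivatives of order at most `k`
belong to `L^p(G)` with respect to Lebesgue measure. -/
def holoLp {n : ℕ} (p : ℝ≥0∞) (k : ℕ) (G : Set (Fin n → ℂ)) : Set ((Fin n → ℂ) → ℂ) :=
  {f | f ∈ holo G ∧ ∀ ν : Fin n → ℕ, ∑ j, ν j ≤ k →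
    MemLp (multiPartial ν f) p (volume.restrict G)}

/-- `𝓗^{∞,k}(G) = L_h^{∞,k}(G)`. -/
def hInfty {n : ℕ} (k : ℕ) (G : Set (Fin n → ℂ)) : Set ((Fin n → ℂ) → ℂ) :=
  holoLp ∞ k G

/-- `𝓐^k(G)`: holomorphic functions on `G` all of whose derivatives of order at most `k` extend
continuously to the closure of `G`. -/
def aSpace {n : ℕ} (k : ℕ) (G : Set (Fin n → ℂ)) : Set ((Fin n → ℂ) → ℂ) :=
  {f | f ∈ holo G ∧ ∀ ν : Fin n → ℕ, ∑ j, ν j ≤ k →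
    ∃ g : (Fin n → ℂ) → ℂ, ContinuousOn g (closure G) ∧ EqOn g (multiPartial ν f) G}

/-- Up to a permutation `σ` of the coordinates, `G = D × ℂ^{n-m}`, where `m ≤ n` and
`D ⊆ ℂ^m` is a fat `m`-circled domain of holomorphy with `𝓔(log D) = {0}`. -/
def IsFatPointedTimesAffine {n : ℕ} (G : Set (Fin n → ℂ)) : Prop :=
  ∃ (m : ℕ) (hm : m ≤ n) (σ : Equiv.Perm (Fin n)) (D : Set (Fin m → ℂ)),
    IsFat D ∧ IsNCircled D ∧ IsDomainOfHolomorphy D ∧ linealitySpace (logSet D) = ⊥ ∧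
      G = {z | (fun i : Fin m => z (σ (Fin.castLE hm i))) ∈ D}

/-! Everything rests on Laurent series. On a circled domain each holomorphic `f` is the sum of its
terms `a_α z^α`, where `a_α z^α` is the average of `f` over the torus orbit of `z` against the
character of weight `-α`. Averaging preserves bounds on `f` and on its first derivatives. The set
where a Laurent series converges absolutely is logarithmically convex, so `log G` is convex.

(ii) implies (i). Let `f` and its first derivatives be bounded, `a_α ≠ 0` and `v ∈ 𝓔(log G)`.
Boundedness of `z^α` along the line in direction `v` gives `⟨α, v⟩ = 0`; if `α_j ≠ 0`, boundedness
of the `j`-th derivative gives `⟨α - e_j, v⟩ = 0`, hence `v_j = 0`. So `f` depends only on the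
coordinates in which all of `𝓔(log G)` vanishes (`eq_of_mem_hInfty_one`), and `G` must be the
cylinder over its projection `D` to them. Bounded functions also extend to the interior of the
closure (`exists_extension_interior_closure`), which makes `G` and `D` fat. A vector of `𝓔(log D)`,
extended by zero, lies in `𝓔(log G)`, hence vanishes.

(i) implies (iii). If all functions extended to some `G₁ ⊄ G`, fatness would give a point `q ∈ G₁`
off the closure of `G` and off the coordinate hyperplanes. As `log D` is convex and contains no
line, some integer `α` separates it from the logarithm of the projection `p` of `q`, with `⟨α, x⟩ ≤
C - (k+1)‖x‖` on `log D` (`exists_int_separating`). This decay makes the derivatives of `z^α` up to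
order `k` bounded and continuous up to the closure. With `c = p^α`, the same holds for `1 / (c -
z^α)`, whose denominator stays away from zero on `D`; yet it has a pole at `q`.

(iii) implies (ii) by taking `k = 1`. -/

/-! ### Holomorphic functions on complex normed spaces -/

open Filter Topology Metric in
theorem norm_fderiv_le_of_bound {E : Type*} [NormedAddCommGroup E] [NormedSpace ℂ E] {f : E → ℂ}
    {z : E} {r M : ℝ} (hr : 0 < r) (hf : DifferentiableOn ℂ f (ball z r))
    (hM : ∀ w ∈ ball z r, ‖f w‖ ≤ M) : ‖fderiv ℂ f z‖ ≤ 2 * M / r := by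
  have hM0 : 0 ≤ M := (norm_nonneg _).trans (hM z (mem_ball_self hr))
  refine ContinuousLinearMap.opNorm_le_bound _ (by positivity) fun v => ?_
  rcases eq_or_ne v 0 with rfl | hv
  · simp
  have hv' : 0 < ‖v‖ := norm_pos_iff.2 hv
  have hmap : ∀ t : ℂ, ‖t‖ ≤ r / 2 / ‖v‖ → z + t • v ∈ ball z r := by
    intro t ht
    rw [mem_ball_iff_norm, add_sub_cancel_left, norm_smul]
    calc ‖t‖ * ‖v‖ ≤ r / 2 / ‖v‖ * ‖v‖ := by gcongr
      _ = r / 2 := by field_simp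
      _ < r := by linarith
  have hd : ∀ t : ℂ, ‖t‖ ≤ r / 2 / ‖v‖ → DifferentiableAt ℂ (fun t : ℂ => f (z + t • v)) t := by
    intro t ht
    have h1 : DifferentiableAt ℂ f (z + t • v) :=
      hf.differentiableAt (isOpen_ball.mem_nhds (hmap t ht))
    exact h1.comp t (by fun_prop)
  have h0 : HasDerivAt (fun t : ℂ => f (z + t • v)) (fderiv ℂ f z v) 0 := by
    have h1 : HasFDerivAt f (fderiv ℂ f z) (z + (0 : ℂ) • v) := by
      simpa using (hf.differentiableAt (isOpen_ball.mem_nhds (mem_ball_self hr))).hasFDerivAt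
    have h2 : HasDerivAt (fun t : ℂ => z + t • v) v 0 := by
      simpa using ((hasDerivAt_id (0 : ℂ)).smul_const v).const_add z
    exact h1.comp_hasDerivAt 0 h2
  -- One-variable Cauchy estimate on the slice through `z` in direction `v`. Halving the radius
  -- keeps the closed disc inside the open ball and costs the factor 2.
  have := Complex.norm_deriv_le_of_forall_mem_sphere_norm_le (c := 0) (R := r / 2 / ‖v‖) (C := M)
    (f := fun t : ℂ => f (z + t • v)) (by positivity)
    (DifferentiableOn.diffContOnCl fun t ht => (hd t (by
      simpa using closure_ball_subset_closedBall ht)).differentiableWithinAt)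
    (fun t ht => hM _ (hmap t (by simpa using ht.le)))
  rw [h0.deriv] at this
  calc _ ≤ _ := this
    _ = _ := by field_simp

-- The Cauchy estimate, applied to the difference of `f` and a small translate of it, turns uniform
-- continuity of `f` into continuity of the derivative.
open Filter Topology Metric in
theorem continuousOn_fderiv_of_differentiableOn {E : Type*} [NormedAddCommGroup E]
    [NormedSpace ℂ E] [ProperSpace E] {f : E → ℂ} {U : Set E} (hU : IsOpen U)
    (hf : DifferentiableOn ℂ f U) : ContinuousOn (fderiv ℂ f) U := by
  intro z hz
  refine ContinuousAt.continuousWithinAt ?_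
  obtain ⟨r, hr, hrU⟩ := nhds_basis_closedBall.mem_iff.1 (hU.mem_nhds hz)
  have huc := (isCompact_closedBall z r).uniformContinuousOn_of_continuous
    (hf.continuousOn.mono hrU)
  rw [Metric.uniformContinuousOn_iff] at huc
  rw [Metric.continuousAt_iff]
  intro ε hε
  obtain ⟨δ, hδ, h⟩ := huc (ε * r / 8) (by positivity)
  refine ⟨min δ (r / 2), by positivity, fun {z'} hz' => ?_⟩
  have hz1 : ‖z' - z‖ < δ := by
    rw [← dist_eq_norm]; exact hz'.trans_le (min_le_left _ _)
  have hz2 : ‖z' - z‖ < r / 2 := by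
    rw [← dist_eq_norm]; exact hz'.trans_le (min_le_right _ _)
  have hin : ∀ w ∈ ball z (r / 2), w + (z' - z) ∈ closedBall z r := by
    intro w hw
    rw [mem_ball_iff_norm] at hw
    rw [mem_closedBall_iff_norm]
    calc ‖w + (z' - z) - z‖ = ‖(w - z) + (z' - z)‖ := by congr 1; abel
      _ ≤ ‖w - z‖ + ‖z' - z‖ := norm_add_le _ _
      _ ≤ r := by linarith
  have hin2 : ∀ w ∈ ball z (r / 2), w ∈ closedBall z r := fun w hw =>
    ball_subset_closedBall (ball_subset_ball (by linarith) hw)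
  have hball : ball z r ⊆ U := ball_subset_closedBall.trans hrU
  have hin3 : ∀ w ∈ ball z (r / 2), w + (z' - z) ∈ ball z r := by
    intro w hw
    rw [mem_ball_iff_norm] at hw ⊢
    calc ‖w + (z' - z) - z‖ = ‖(w - z) + (z' - z)‖ := by congr 1; abel
      _ ≤ ‖w - z‖ + ‖z' - z‖ := norm_add_le _ _
      _ < r := by linarith
  have hd1 : ∀ w ∈ ball z (r / 2), DifferentiableAt ℂ f w := fun w hw =>
    hf.differentiableAt (hU.mem_nhds (hball (ball_subset_ball (by linarith) hw)))
  have hd2 : ∀ w ∈ ball z (r / 2), DifferentiableAt ℂ f (w + (z' - z)) := fun w hw =>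
    hf.differentiableAt (hU.mem_nhds (hball (hin3 w hw)))
  have hd3 : ∀ w ∈ ball z (r / 2), DifferentiableAt ℂ (fun w => f (w + (z' - z))) w := fun w hw =>
    (hd2 w hw).comp w (by fun_prop)
  have hzz : z ∈ ball z (r / 2) := mem_ball_self (by positivity)
  have key := norm_fderiv_le_of_bound (f := fun w => f (w + (z' - z)) - f w) (z := z) (r := r / 2)
    (M := ε * r / 8) (by positivity)
    (fun w hw => ((hd3 w hw).sub (hd1 w hw)).differentiableWithinAt)
    (fun w hw => by
      rw [← dist_eq_norm]
      refine (h _ (hin w hw) _ (hin2 w hw) ?_).le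
      rw [dist_eq_norm, add_sub_cancel_left]; exact hz1)
  rw [fderiv_fun_sub (hd3 z hzz) (hd1 z hzz), fderiv_comp_add_right, add_sub_cancel] at key
  rw [dist_eq_norm]
  refine key.trans_lt ?_
  have : 2 * (ε * r / 8) / (r / 2) = ε / 2 := by field_simp; norm_num
  rw [this]; linarith

open Filter Topology Metric in
theorem differentiableOn_tsum_of_bound {E ι : Type*} [NormedAddCommGroup E] [NormedSpace ℂ E]
    {F : ι → E → ℂ} {u : ι → ℝ} {U : Set E} (hU : IsOpen U) (hu : Summable u)
    (hF : ∀ i, DifferentiableOn ℂ (F i) U) (hb : ∀ i, ∀ z ∈ U, ‖F i z‖ ≤ u i) :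
    DifferentiableOn ℂ (fun z => ∑' i, F i z) U := by
  intro z hz
  obtain ⟨r, hr, hrU⟩ := Metric.isOpen_iff.1 hU z hz
  have hsub : ∀ w ∈ ball z (r / 2), ball w (r / 2) ⊆ U := fun w hw => by
    refine (ball_subset ?_).trans hrU
    rw [mem_ball] at hw
    linarith
  have hzz : z ∈ ball z (r / 2) := mem_ball_self (by positivity)
  let _ : NormedSpace ℝ E := NormedSpace.restrictScalars ℝ ℂ E
  have := hasFDerivAt_tsum_of_isPreconnected (𝕜 := ℂ) (f := F) (f' := fun i w => fderiv ℂ (F i) w)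
    (u := fun i => 2 * u i / (r / 2)) (s := ball z (r / 2)) (x₀ := z) (x := z)
    ((hu.mul_left 2).div_const _) isOpen_ball (convex_ball z (r / 2)).isPreconnected
    (fun i w hw => ((hF i).differentiableAt (hU.mem_nhds
      (hsub w hw (mem_ball_self (by positivity))))).hasFDerivAt)
    (fun i w hw => norm_fderiv_le_of_bound (by positivity) ((hF i).mono (hsub w hw))
      fun x hx => hb i x (hsub w hw hx))
    hzz (Summable.of_norm_bounded hu fun i => hb i z hz) hzz
  exact this.differentiableAt.differentiableWithinAt

-- On a ball the one-variable identity theorem along complex lines spreads equality from a single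
-- interior point of agreement. Hence the interior of `{f = g}` is relatively closed in `U`.
open Filter Topology Metric in
theorem eqOn_of_eqOn_open {E : Type*} [NormedAddCommGroup E] [NormedSpace ℂ E]
    {f g : E → ℂ} {U V : Set E} (hU : IsOpen U) (hUc : IsPreconnected U)
    (hf : DifferentiableOn ℂ f U) (hg : DifferentiableOn ℂ g U)
    (hV : IsOpen V) (hVn : V.Nonempty) (hVU : V ⊆ U) (hfg : EqOn f g V) : EqOn f g U := by
  let _ : NormedSpace ℝ E := NormedSpace.restrictScalars ℝ ℂ E
  set A : Set E := interior {z | f z = g z} with hA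
  have hAfg : ∀ z ∈ A, f z = g z := fun z hz => interior_subset (s := {z | f z = g z}) hz
  have hball : ∀ z r w, ball z r ⊆ U → w ∈ ball z r → w ∈ A → ∀ u ∈ ball z r, f u = g u := by
    intro z r w hzU hw hwA u hu
    set L : ℂ → E := fun t => w + t • (u - w) with hL
    have hLd : Differentiable ℂ L := by fun_prop
    have hLc : Continuous L := hLd.continuous
    set S : Set ℂ := L ⁻¹' ball z r with hS
    have hSo : IsOpen S := isOpen_ball.preimage hLc
    have hSc : Convex ℝ S := by
      intro s hs t ht a b ha hb hab
      have h1 : L (a • s + b • t) = a • L s + b • L t := by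
        have hab' : (a : ℂ) + b = 1 := by exact_mod_cast hab
        have e : ∀ (c : ℝ) (x : E), c • x = (c : ℂ) • x := fun c x => rfl
        simp only [hL, e]
        simp only [Complex.real_smul]
        have hw1 : w = ((a : ℂ) + b) • w := by rw [hab', one_smul]
        calc w + ((a : ℂ) * s + b * t) • (u - w)
            = ((a : ℂ) + b) • w + ((a : ℂ) * s + b * t) • (u - w) := by rw [← hw1]
          _ = _ := by module
      show L (a • s + b • t) ∈ ball z r
      rw [h1]
      exact convex_ball z r hs ht ha hb hab
    have hdf : ∀ h : E → ℂ, DifferentiableOn ℂ h U → AnalyticOnNhd ℂ (h ∘ L) S := by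
      intro h hh
      refine DifferentiableOn.analyticOnNhd ?_ hSo
      exact (hh.mono hzU).comp hLd.differentiableOn (fun t ht => ht)
    have h0 : (0 : ℂ) ∈ S := by simpa [hS, hL] using hw
    have h1 : (1 : ℂ) ∈ S := by simpa [hS, hL] using hu
    have hev : f ∘ L =ᶠ[𝓝 0] g ∘ L := by
      have : A ∈ 𝓝 (L 0) := by
        have : L 0 = w := by simp [hL]
        rw [this]; exact isOpen_interior.mem_nhds hwA
      filter_upwards [hLc.continuousAt this] with t ht
      exact hAfg _ ht
    have := (hdf f hf).eqOn_of_preconnected_of_eventuallyEq (hdf g hg) hSc.isPreconnected h0 hev h1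
    simpa [hL] using this
  have hsub : U ⊆ A := by
    refine hUc.subset_of_closure_inter_subset isOpen_interior ?_ ?_
    · obtain ⟨v, hv⟩ := hVn
      exact ⟨v, hVU hv, interior_maximal hfg hV hv⟩
    · rintro z ⟨hzA, hzU⟩
      obtain ⟨r, hr, hrU⟩ := Metric.isOpen_iff.1 hU z hzU
      obtain ⟨w, hw, hwA⟩ := mem_closure_iff_nhds.1 hzA (ball z r) (ball_mem_nhds z hr)
      exact interior_maximal (fun u hu => hball z r w hrU hw hwA u hu) isOpen_ball
        (mem_ball_self hr)
  exact fun z hz => hAfg z (hsub hz)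

/-! ### The complement of the coordinate hyperplanes -/

/-- The set of points of `ℂⁿ` all of whose coordinates are nonzero. -/
def nonvanishing (n : ℕ) : Set (Fin n → ℂ) := {z | ∀ j, z j ≠ 0}

theorem nonvanishing_eq_pi (n : ℕ) :
    nonvanishing n = Set.pi univ fun _ => ({0}ᶜ : Set ℂ) := by
  ext z; simp [nonvanishing]

theorem isOpen_nonvanishing (n : ℕ) : IsOpen (nonvanishing n) := by
  rw [nonvanishing_eq_pi]
  exact isOpen_set_pi finite_univ fun _ _ => isOpen_compl_singleton

theorem dense_nonvanishing (n : ℕ) : Dense (nonvanishing n) := by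
  rw [nonvanishing_eq_pi]
  exact dense_pi univ fun _ _ => dense_compl_singleton 0

open Metric in
theorem isPreconnected_ball_diff_zero (c : ℂ) (r : ℝ) : IsPreconnected (ball c r ∩ {0}ᶜ) := by
  rcases le_or_gt r 0 with hr | hr
  · rw [ball_eq_empty.2 hr, empty_inter]; exact isPreconnected_empty
  by_cases h0 : (0 : ℂ) ∈ ball c r
  -- The disc is homeomorphic to the plane, and the plane minus a point is connected.
  · set e := OpenPartialHomeomorph.univBall c r with he
    have ht : e.target = ball c r := OpenPartialHomeomorph.univBall_target c hr
    have hs : e.source = univ := OpenPartialHomeomorph.univBall_source c r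
    have hc := (isConnected_compl_singleton_of_one_lt_rank (E := ℂ) (by simp)
      (e.symm 0)).isPreconnected
    suffices heq : ball c r ∩ {0}ᶜ = e '' {e.symm 0}ᶜ by
      rw [heq]; exact hc.image e (e.continuousOn.mono (by simp [hs]))
    ext z
    constructor
    · rintro ⟨hz, hz0⟩
      refine ⟨e.symm z, fun h => hz0 ?_, e.right_inv (ht ▸ hz)⟩
      rw [← e.right_inv (x := z) (ht ▸ hz), h, e.right_inv (ht ▸ h0)]; rfl
    · rintro ⟨w, hw, rfl⟩
      have hws : w ∈ e.source := hs ▸ mem_univ w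
      refine ⟨ht ▸ e.map_source hws, fun h => hw ?_⟩
      rw [mem_singleton_iff] at h
      rw [mem_singleton_iff, ← h, e.left_inv hws]
  · rw [inter_eq_left.2]
    · exact (convex_ball c r).isPreconnected
    · rintro z hz rfl
      exact h0 hz

-- A polydisc minus the hyperplanes is a product of connected sets. By density the closures of the
-- two pieces of a separation cover `G`, so they share a point of `G`, and a polydisc around it
-- meets both pieces.
open Metric Topology in
theorem isPreconnected_inter_nonvanishing {n : ℕ} {G : Set (Fin n → ℂ)} (hG : IsOpen G)
    (hc : IsPreconnected G) : IsPreconnected (G ∩ nonvanishing n) := by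
  have hloc : ∀ p ∈ G, ∃ P ∈ 𝓝 p, P ⊆ G ∧ IsPreconnected (P ∩ nonvanishing n) := by
    intro p hp
    obtain ⟨r, hr, hrG⟩ := Metric.isOpen_iff.1 hG p hp
    refine ⟨ball p r, ball_mem_nhds p hr, hrG, ?_⟩
    rw [ball_pi p hr, nonvanishing_eq_pi, ← pi_inter_distrib]
    exact isPreconnected_univ_pi fun i => isPreconnected_ball_diff_zero _ _
  have hopen : IsOpen (G ∩ nonvanishing n) := hG.inter (isOpen_nonvanishing n)
  have hdense : G ⊆ closure (G ∩ nonvanishing n) := by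
    have := (dense_nonvanishing n).open_subset_closure_inter hG
    exact this
  intro U V hU hV hUV hnU hnV
  by_contra hne
  have hcov : G ⊆ closure (G ∩ nonvanishing n ∩ U) ∪ closure (G ∩ nonvanishing n ∩ V) := by
    rw [← closure_union, ← inter_union_distrib_left, inter_eq_left.2 hUV]
    exact hdense
  have hsubset : ∀ W : Set (Fin n → ℂ), (G ∩ nonvanishing n ∩ W).Nonempty →
      (G ∩ closure (G ∩ nonvanishing n ∩ W)).Nonempty := by
    rintro W ⟨x, hx⟩
    exact ⟨x, hx.1.1, subset_closure hx⟩
  obtain ⟨p, hpG, hpU, hpV⟩ := isPreconnected_closed_iff.1 hc _ _ isClosed_closure isClosed_closure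
    hcov (hsubset U hnU) (hsubset V hnV)
  obtain ⟨P, hP, hPG, hPc⟩ := hloc p hpG
  obtain ⟨x, hxP, hx⟩ := mem_closure_iff_nhds.1 hpU P hP
  obtain ⟨y, hyP, hy⟩ := mem_closure_iff_nhds.1 hpV P hP
  obtain ⟨w, hw, hwU, hwV⟩ := hPc U V hU hV (fun z hz => hUV ⟨hPG hz.1, hz.2⟩)
    ⟨x, ⟨hxP, hx.1.2⟩, hx.2⟩ ⟨y, ⟨hyP, hy.1.2⟩, hy.2⟩
  exact hne ⟨w, ⟨hPG hw.1, hw.2⟩, hwU, hwV⟩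

/-! ### Laurent expansions on circled domains -/

theorem summable_prod_pi_of_nonneg {g : ℤ → ℝ} (hg0 : ∀ k, 0 ≤ g k) (hg : Summable g) :
    ∀ n : ℕ, Summable fun α : Fin n → ℤ => ∏ j, g (α j)
  | 0 => by
    have : Finite (Fin 0 → ℤ) := inferInstance
    exact Summable.of_finite
  | n + 1 => by
    have ih := summable_prod_pi_of_nonneg hg0 hg n
    have := hg.mul_of_nonneg ih hg0 (fun α => Finset.prod_nonneg fun j _ => hg0 _)
    rw [← (Fin.consEquiv fun _ : Fin (n + 1) => ℤ).summable_iff]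
    refine this.congr fun p => ?_
    simp [Fin.prod_univ_succ, Fin.consEquiv]

theorem summable_zpow_neg_natAbs {ρ : ℝ} (hρ : 1 < ρ) :
    Summable fun k : ℤ => (ρ⁻¹) ^ k.natAbs := by
  have h : Summable fun k : ℕ => (ρ⁻¹) ^ k :=
    summable_geometric_of_lt_one (by positivity) (inv_lt_one_of_one_lt₀ hρ)
  refine Summable.of_nat_of_neg (by simpa using h) (by simpa using h)

/-- The Laurent monomial `z ↦ z^α = ∏ⱼ zⱼ^{αⱼ}`. -/
noncomputable def laurentMonomial {n : ℕ} (α : Fin n → ℤ) (z : Fin n → ℂ) : ℂ := ∏ j, z j ^ α j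

/-- The point `(e^{2πiθ₁}, …, e^{2πiθₙ})` of the unit torus in `ℂⁿ`. -/
noncomputable def torusPoint {n : ℕ} (θ : UnitAddTorus (Fin n)) : Fin n → ℂ :=
  fun j => fourier 1 (θ j)

/-- The normalized Haar measure of the torus. -/
noncomputable def torusMeasure (n : ℕ) : Measure (UnitAddTorus (Fin n)) :=
  Measure.pi fun _ => AddCircle.haarAddCircle

instance (n : ℕ) : IsProbabilityMeasure (torusMeasure n) := by
  unfold torusMeasure; infer_instance

instance (n : ℕ) : (torusMeasure n).IsAddHaarMeasure := by
  unfold torusMeasure; infer_instance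

theorem norm_torusPoint {n : ℕ} (θ : UnitAddTorus (Fin n)) (j : Fin n) : ‖torusPoint θ j‖ = 1 :=
  Circle.norm_coe _

theorem continuous_torusPoint {n : ℕ} : Continuous (torusPoint (n := n)) := by
  unfold torusPoint; fun_prop

theorem torusPoint_add {n : ℕ} (θ φ : UnitAddTorus (Fin n)) :
    torusPoint (θ + φ) = torusPoint θ * torusPoint φ := by
  ext j
  simp [torusPoint, fourier_apply, AddCircle.toCircle_add]

theorem torusPoint_zero {n : ℕ} : torusPoint (0 : UnitAddTorus (Fin n)) = 1 := by
  ext j; simp [torusPoint]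

theorem laurentMonomial_torusPoint {n : ℕ} (α : Fin n → ℤ) (θ : UnitAddTorus (Fin n)) :
    laurentMonomial α (torusPoint θ) = UnitAddTorus.mFourier α θ := by
  simp [laurentMonomial, torusPoint, UnitAddTorus.mFourier, fourier_apply, AddCircle.toCircle_zsmul]

theorem laurentMonomial_mul {n : ℕ} (α : Fin n → ℤ) (z w : Fin n → ℂ) :
    laurentMonomial α (z * w) = laurentMonomial α z * laurentMonomial α w := by
  simp [laurentMonomial, mul_zpow, Finset.prod_mul_distrib]

theorem norm_laurentMonomial {n : ℕ} (α : Fin n → ℤ) (z : Fin n → ℂ) :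
    ‖laurentMonomial α z‖ = ∏ j, ‖z j‖ ^ α j := by
  simp [laurentMonomial]

theorem differentiableAt_laurentMonomial {n : ℕ} (α : Fin n → ℤ) {z : Fin n → ℂ}
    (hz : ∀ j, z j = 0 → 0 ≤ α j) : DifferentiableAt ℂ (laurentMonomial α) z := by
  unfold laurentMonomial
  suffices h : ∀ j, DifferentiableAt ℂ (fun z : Fin n → ℂ => z j ^ α j) z by
    classical
    exact (HasFDerivAt.finsetProd (u := Finset.univ) fun j _ => (h j).hasFDerivAt).differentiableAt
  intro j
  have h1 : DifferentiableAt ℂ (fun w : ℂ => w ^ α j) (z j) :=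
    differentiableAt_zpow.2 (by by_cases h : z j = 0 <;> simp [h, hz j])
  exact h1.comp z (differentiableAt_apply (𝕜 := ℂ) j z)

theorem IsNCircled.mul_mem {n : ℕ} {G : Set (Fin n → ℂ)} (hG : IsNCircled G) {u z : Fin n → ℂ}
    (hu : ∀ j, ‖u j‖ = 1) (hz : z ∈ G) : u * z ∈ G := by
  have := hG z hz fun j => Complex.arg (u j)
  convert! this using 2 with j
  have h := Complex.norm_mul_exp_arg_mul_I (u j)
  rw [hu j] at h
  rw [Pi.mul_apply, mul_comm Complex.I]
  simp only [Complex.ofReal_one, one_mul] at h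
  rw [h]

theorem IsNCircled.mem_of_norm_eq {n : ℕ} {G : Set (Fin n → ℂ)} (hG : IsNCircled G)
    {z w : Fin n → ℂ} (hzw : ∀ j, ‖z j‖ = ‖w j‖) (hz : z ∈ G) : w ∈ G := by
  have : w = (fun j => if z j = 0 then 1 else w j / z j) * z := by
    ext j
    by_cases h : z j = 0
    · have := hzw j
      rw [h, norm_zero] at this
      simp [h, norm_eq_zero.1 this.symm]
    · simp [h]
  rw [this]
  refine hG.mul_mem (fun j => ?_) hz
  by_cases h : z j = 0
  · simp [h]
  · have : ‖z j‖ ≠ 0 := by simpa using h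
    simp [h, ← hzw j, this]

/-- The Laurent coefficient function `z ↦ ∫ e^{-2πi⟨α,θ⟩} f(e^{2πiθ} z) dθ`, which equals `a_α z^α`
on Reinhardt domains. -/
noncomputable def laurentCoeffFun {n : ℕ} (f : (Fin n → ℂ) → ℂ) (α : Fin n → ℤ) (z : Fin n → ℂ) : ℂ :=
  ∫ θ, UnitAddTorus.mFourier (-α) θ * f (torusPoint θ * z) ∂torusMeasure n

theorem norm_mFourier_apply {n : ℕ} (α : Fin n → ℤ) (θ : UnitAddTorus (Fin n)) :
    ‖UnitAddTorus.mFourier α θ‖ = 1 := by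
  rw [← laurentMonomial_torusPoint, norm_laurentMonomial]
  simp [norm_torusPoint]

theorem norm_laurentCoeffFun_le {n : ℕ} {f : (Fin n → ℂ) → ℂ} (α : Fin n → ℤ) {z : Fin n → ℂ}
    {M : ℝ} (hM : ∀ θ, ‖f (torusPoint θ * z)‖ ≤ M) : ‖laurentCoeffFun f α z‖ ≤ M := by
  have := norm_integral_le_of_norm_le_const (μ := torusMeasure n) (C := M)
    (f := fun θ => UnitAddTorus.mFourier (-α) θ * f (torusPoint θ * z))
    (Filter.Eventually.of_forall fun θ => by
      rw [norm_mul, norm_mFourier_apply, one_mul]; exact hM θ)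
  simpa [laurentCoeffFun] using this

theorem laurentCoeffFun_torusPoint_mul {n : ℕ} (f : (Fin n → ℂ) → ℂ) (α : Fin n → ℤ)
    (φ : UnitAddTorus (Fin n)) (z : Fin n → ℂ) :
    laurentCoeffFun f α (torusPoint φ * z) =
      laurentMonomial α (torusPoint φ) * laurentCoeffFun f α z := by
  unfold laurentCoeffFun
  rw [← integral_const_mul]
  refine Eq.trans ?_ (integral_add_right_eq_self (μ := torusMeasure n) _ φ)
  refine integral_congr_ae (Filter.Eventually.of_forall fun θ => ?_)
  simp only
  rw [← laurentMonomial_torusPoint, ← laurentMonomial_torusPoint, torusPoint_add,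
    laurentMonomial_mul, ← mul_assoc (torusPoint θ)]
  have h : laurentMonomial α (torusPoint φ) * laurentMonomial (-α) (torusPoint φ) = 1 := by
    unfold laurentMonomial
    rw [← Finset.prod_mul_distrib]
    refine Finset.prod_eq_one fun j _ => ?_
    have : torusPoint φ j ≠ 0 := by
      rw [← norm_ne_zero_iff, norm_torusPoint]; exact one_ne_zero
    rw [Pi.neg_apply, zpow_neg, mul_inv_cancel₀ (zpow_ne_zero _ this)]
  linear_combination (-laurentMonomial (-α) (torusPoint θ) * f (torusPoint θ * torusPoint φ * z)) * h

-- Differentiation under the integral: on a closed ball times the compact torus the derivative of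
-- the integrand is continuous, hence dominated by a constant.
open Metric Topology in
theorem hasFDerivAt_laurentCoeffFun {n : ℕ} {G : Set (Fin n → ℂ)} (hG : IsOpen G)
    (hc : IsNCircled G) {f : (Fin n → ℂ) → ℂ} (hf : DifferentiableOn ℂ f G) (α : Fin n → ℤ)
    {z : Fin n → ℂ} (hz : z ∈ G) :
    Integrable (fun θ => UnitAddTorus.mFourier (-α) θ • (fderiv ℂ f (torusPoint θ * z)).comp
        (ContinuousLinearMap.mul ℂ (Fin n → ℂ) (torusPoint θ))) (torusMeasure n) ∧
    HasFDerivAt (laurentCoeffFun f α)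
      (∫ θ, UnitAddTorus.mFourier (-α) θ • (fderiv ℂ f (torusPoint θ * z)).comp
        (ContinuousLinearMap.mul ℂ (Fin n → ℂ) (torusPoint θ)) ∂torusMeasure n) z := by
  set F' : (Fin n → ℂ) → UnitAddTorus (Fin n) → (Fin n → ℂ) →L[ℂ] ℂ := fun w θ =>
    UnitAddTorus.mFourier (-α) θ • (fderiv ℂ f (torusPoint θ * w)).comp
        (ContinuousLinearMap.mul ℂ (Fin n → ℂ) (torusPoint θ)) with hF'
  obtain ⟨r, hr, hrG⟩ := nhds_basis_closedBall.mem_iff.1 (hG.mem_nhds hz)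
  have hmem : ∀ θ, ∀ w ∈ closedBall z r, torusPoint θ * w ∈ G := fun θ w hw =>
    hc.mul_mem (norm_torusPoint θ) (hrG hw)
  have hzz : z ∈ closedBall z r := mem_closedBall_self hr.le
  have hmap : Continuous fun p : (Fin n → ℂ) × UnitAddTorus (Fin n) => torusPoint p.2 * p.1 :=
    (continuous_torusPoint.comp continuous_snd).mul continuous_fst
  have hcont : ContinuousOn (fun p : (Fin n → ℂ) × UnitAddTorus (Fin n) => F' p.1 p.2)
      (closedBall z r ×ˢ univ) := by
    refine ContinuousOn.smul ((map_continuous (UnitAddTorus.mFourier (-α))).comp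
      continuous_snd).continuousOn ?_
    refine ContinuousOn.clm_comp ?_ ?_
    · exact (continuousOn_fderiv_of_differentiableOn hG hf).comp hmap.continuousOn
        fun p hp => hmem p.2 p.1 hp.1
    · exact ((ContinuousLinearMap.mul ℂ (Fin n → ℂ)).continuous.comp
        (continuous_torusPoint.comp continuous_snd)).continuousOn
  obtain ⟨B, hB⟩ := ((isCompact_closedBall z r).prod isCompact_univ).exists_bound_of_continuousOn
    hcont
  have hcz : ∀ w ∈ closedBall z r, Continuous fun θ => F' w θ := by
    intro w hw
    rw [← continuousOn_univ]
    exact hcont.comp (f := fun θ => (w, θ)) (by fun_prop) fun θ _ => ⟨hw, mem_univ _⟩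
  have hcf : ∀ w ∈ closedBall z r, Continuous fun θ =>
      UnitAddTorus.mFourier (-α) θ * f (torusPoint θ * w) := by
    intro w hw
    refine (map_continuous _).mul ?_
    rw [← continuousOn_univ]
    exact hf.continuousOn.comp (continuous_torusPoint.mul continuous_const).continuousOn
      fun θ _ => hmem θ w hw
  have hint : ∀ {E : Type} [NormedAddCommGroup E] (g : UnitAddTorus (Fin n) → E), Continuous g →
      Integrable g (torusMeasure n) := fun g hg =>
    hg.integrable_of_hasCompactSupport (HasCompactSupport.of_compactSpace _)
  refine ⟨hint _ (hcz z hzz), ?_⟩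
  refine hasFDerivAt_integral_of_dominated_of_fderiv_le (F' := F') (bound := fun _ => B)
    (closedBall_mem_nhds z hr) ?_ (hint _ (hcf z hzz)) (hint _ (hcz z hzz)).aestronglyMeasurable
    ?_ (integrable_const B) ?_
  · filter_upwards [closedBall_mem_nhds z hr] with w hw
    exact (hint _ (hcf w hw)).aestronglyMeasurable
  · exact Filter.Eventually.of_forall fun θ w hw => hB (w, θ) ⟨hw, mem_univ _⟩
  · refine Filter.Eventually.of_forall fun θ w hw => ?_
    have h1 : HasFDerivAt f (fderiv ℂ f (torusPoint θ * w)) (torusPoint θ * w) :=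
      (hf.differentiableAt (hG.mem_nhds (hmem θ w hw))).hasFDerivAt
    have h2 : HasFDerivAt (fun w => torusPoint θ * w)
        (ContinuousLinearMap.mul ℂ (Fin n → ℂ) (torusPoint θ)) w :=
      (ContinuousLinearMap.mul ℂ (Fin n → ℂ) (torusPoint θ)).hasFDerivAt
    exact (h1.comp w h2).const_mul (UnitAddTorus.mFourier (-α) θ)

theorem norm_fderiv_laurentCoeffFun_single_le {n : ℕ} {G : Set (Fin n → ℂ)} (hG : IsOpen G)
    (hc : IsNCircled G) {f : (Fin n → ℂ) → ℂ} (hf : DifferentiableOn ℂ f G) (α : Fin n → ℤ)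
    {j : Fin n} {M : ℝ} (hM : ∀ z ∈ G, ‖fderiv ℂ f z (Pi.single j 1)‖ ≤ M)
    {z : Fin n → ℂ} (hz : z ∈ G) :
    ‖fderiv ℂ (laurentCoeffFun f α) z (Pi.single j 1)‖ ≤ M := by
  obtain ⟨hi, hd⟩ := hasFDerivAt_laurentCoeffFun hG hc hf α hz
  rw [hd.fderiv, ContinuousLinearMap.integral_apply hi]
  refine (norm_integral_le_of_norm_le_const (C := M)
    (Filter.Eventually.of_forall fun θ => ?_)).trans (by simp)
  have h1 : torusPoint θ * Pi.single j 1 = torusPoint θ j • (Pi.single j 1 : Fin n → ℂ) := by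
    ext i
    by_cases h : i = j
    · subst h; simp
    · simp [h]
  simp only [FunLike.coe_smul, Pi.smul_apply, ContinuousLinearMap.coe_comp, Function.comp_apply,
    ContinuousLinearMap.mul_apply', h1, map_smul, norm_smul, norm_mFourier_apply, norm_torusPoint,
    one_mul]
  exact hM _ (hc.mul_mem (norm_torusPoint θ) hz)

theorem laurentMonomial_neg_mul_self {n : ℕ} (α : Fin n → ℤ) {z : Fin n → ℂ}
    (hz : z ∈ nonvanishing n) : laurentMonomial (-α) z * laurentMonomial α z = 1 := by
  unfold laurentMonomial
  rw [← Finset.prod_mul_distrib]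
  refine Finset.prod_eq_one fun j _ => ?_
  rw [Pi.neg_apply, zpow_neg, inv_mul_cancel₀ (zpow_ne_zero _ (hz j))]

theorem torusPoint_single_mul {n : ℕ} (j : Fin n) (t : ℝ) (z : Fin n → ℂ) :
    torusPoint (Pi.single j (t : UnitAddCircle)) * z =
      z + ((Complex.exp (2 * Real.pi * Complex.I * t) - 1) * z j) • Pi.single j 1 := by
  ext i
  by_cases h : i = j
  · subst h
    simp only [torusPoint, Pi.mul_apply, Pi.single_eq_same, fourier_coe_apply, Pi.add_apply,
      Pi.smul_apply, smul_eq_mul, mul_one]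
    simp only [Int.cast_one, mul_one, Complex.ofReal_one, div_one]
    ring
  · simp [torusPoint, h]

/-- Rotating only the `j`-th coordinate differentiates `A` in the complex direction `2πi z_j e_j`.
Invariance makes this zero, and `z_j ≠ 0` can be cancelled. -/
theorem fderiv_eq_zero_of_torus_invariant {n : ℕ} {A : (Fin n → ℂ) → ℂ} {z : Fin n → ℂ}
    (hz : z ∈ nonvanishing n) (hA : DifferentiableAt ℂ A z)
    (hinv : ∀ θ : UnitAddTorus (Fin n), A (torusPoint θ * z) = A z) : fderiv ℂ A z = 0 := by
  have key : ∀ j, fderiv ℂ A z (Pi.single j 1) = 0 := by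
    intro j
    have h1 : HasDerivAt (fun t : ℝ => Complex.exp (2 * Real.pi * Complex.I * t))
        (2 * Real.pi * Complex.I) 0 := by
      have h2 : HasDerivAt (fun t : ℝ => 2 * Real.pi * Complex.I * (t : ℂ))
          (2 * Real.pi * Complex.I) 0 := by
        simpa using (Complex.ofRealCLM.hasDerivAt (x := (0 : ℝ))).const_mul
          (2 * (Real.pi : ℂ) * Complex.I)
      simpa using h2.cexp
    have h3 : HasDerivAt (fun t : ℝ => z + ((Complex.exp (2 * Real.pi * Complex.I * t) - 1) * z j) •
        (Pi.single j 1 : Fin n → ℂ)) ((2 * Real.pi * Complex.I * z j) • Pi.single j 1) 0 :=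
      (((h1.sub_const 1).mul_const (z j)).smul_const _).const_add z
    have h4 : HasFDerivAt A (fderiv ℂ A z)
        (z + ((Complex.exp (2 * Real.pi * Complex.I * (0 : ℝ)) - 1) * z j) •
        (Pi.single j 1 : Fin n → ℂ)) := by
      simpa using hA.hasFDerivAt
    have h5 := (h4.restrictScalars ℝ).comp_hasDerivAt (0 : ℝ) h3
    have h6 : (A ∘ fun t : ℝ => z + ((Complex.exp (2 * Real.pi * Complex.I * t) - 1) * z j) •
        (Pi.single j 1 : Fin n → ℂ)) = fun _ => A z := by
      ext t
      rw [Function.comp_apply, ← torusPoint_single_mul, hinv]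
    rw [h6] at h5
    have h7 := h5.unique (hasDerivAt_const (0 : ℝ) (A z))
    simpa [hz j, Real.pi_ne_zero] using h7
  apply ContinuousLinearMap.coe_injective
  refine LinearMap.pi_ext' fun j => ?_
  ext
  simpa using key j

/-- On the part of a connected Reinhardt domain off the coordinate hyperplanes, the Laurent
coefficient functions are multiples of the Laurent monomials. -/
theorem exists_laurentCoeff {n : ℕ} {G : Set (Fin n → ℂ)} (hG : IsOpen G) (hconn : IsPreconnected G)
    (hc : IsNCircled G) {f : (Fin n → ℂ) → ℂ} (hf : DifferentiableOn ℂ f G) :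
    ∃ a : (Fin n → ℤ) → ℂ, ∀ α, ∀ z ∈ G ∩ nonvanishing n,
      laurentCoeffFun f α z = a α * laurentMonomial α z := by
  have hopen := hG.inter (isOpen_nonvanishing n)
  have hpre := isPreconnected_inter_nonvanishing hG hconn
  have key : ∀ α : Fin n → ℤ, ∃ a : ℂ, ∀ z ∈ G ∩ nonvanishing n,
      laurentCoeffFun f α z * laurentMonomial (-α) z = a := by
    -- Dividing by `z^α` cancels the weight under rotation, so the quotient is torus-invariant and
    -- therefore constant.
    intro α
    have hd : ∀ z ∈ G ∩ nonvanishing n,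
        DifferentiableAt ℂ (fun z => laurentCoeffFun f α z * laurentMonomial (-α) z) z :=
      fun z hz => ((hasFDerivAt_laurentCoeffFun hG hc hf α hz.1).2.differentiableAt).mul
        (differentiableAt_laurentMonomial _ fun j hj => absurd hj (hz.2 j))
    refine hopen.exists_is_const_of_fderiv_eq_zero hpre
      (fun z hz => (hd z hz).differentiableWithinAt) fun z hz => ?_
    refine fderiv_eq_zero_of_torus_invariant hz.2 (hd z hz) fun θ => ?_
    rw [laurentCoeffFun_torusPoint_mul, laurentMonomial_mul]
    have h1 : laurentMonomial (-α) (torusPoint θ) * laurentMonomial α (torusPoint θ) = 1 :=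
      laurentMonomial_neg_mul_self α fun j => by
        rw [← norm_ne_zero_iff, norm_torusPoint]; exact one_ne_zero
    linear_combination (laurentCoeffFun f α z * laurentMonomial (-α) z) * h1
  choose a ha using key
  refine ⟨a, fun α z hz => ?_⟩
  rw [← ha α z hz, mul_assoc, laurentMonomial_neg_mul_self α hz.2, mul_one]

/-- Scaling the `j`-th coordinate by `ρ` or `ρ⁻¹` according to the sign of `α j`. -/
noncomputable def signScale {n : ℕ} (ρ : ℝ) (s : Fin n → Bool) (z : Fin n → ℂ) : Fin n → ℂ :=
  fun j => (if s j then (ρ : ℂ) else (ρ : ℂ)⁻¹) * z j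

theorem laurentMonomial_signScale {n : ℕ} {ρ : ℝ} (α : Fin n → ℤ) (z : Fin n → ℂ) :
    laurentMonomial α (signScale ρ (fun j => decide (0 ≤ α j)) z) =
      (∏ j, (ρ : ℂ) ^ (α j).natAbs) * laurentMonomial α z := by
  unfold laurentMonomial signScale
  rw [← Finset.prod_mul_distrib]
  refine Finset.prod_congr rfl fun j _ => ?_
  rw [mul_zpow]
  congr 1
  by_cases h : 0 ≤ α j
  · simp only [h, decide_true, if_true]
    conv_lhs => rw [← Int.natAbs_of_nonneg h]
    exact zpow_natCast _ _
  · simp only [h, decide_false, Bool.false_eq_true, if_false, inv_zpow']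
    conv_lhs => rw [← Int.ofNat_natAbs_of_nonpos (by omega : α j ≤ 0)]
    exact zpow_natCast _ _

open Metric Topology Filter in
theorem exists_signScale_mem {n : ℕ} {U : Set (Fin n → ℂ)} (hU : IsOpen U) {z : Fin n → ℂ}
    (hz : z ∈ U) : ∃ ρ : ℝ, 1 < ρ ∧ ∀ s, signScale ρ s z ∈ U := by
  have h : ∀ s : Fin n → Bool, ∀ᶠ ρ : ℝ in 𝓝 1, signScale ρ s z ∈ U := by
    intro s
    have hc : ContinuousAt (fun ρ : ℝ => signScale ρ s z) 1 := by
      unfold signScale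
      refine continuousAt_pi.2 fun j => ?_
      refine ContinuousAt.mul ?_ continuousAt_const
      split_ifs
      · fun_prop
      · exact ContinuousAt.inv₀ (by fun_prop) (by simp)
    have h1 : signScale 1 s z = z := by ext j; simp [signScale]
    exact hc (by simp only [h1]; exact hU.mem_nhds hz)
  have h2 : ∀ᶠ ρ : ℝ in 𝓝[>] 1, ∀ s, signScale ρ s z ∈ U :=
    (eventually_all.2 h).filter_mono nhdsWithin_le_nhds
  obtain ⟨ρ, hρ, h1⟩ := (h2.and self_mem_nhdsWithin).exists
  exact ⟨ρ, h1, hρ⟩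

theorem summable_laurentCoeff {n : ℕ} {G : Set (Fin n → ℂ)} (hG : IsOpen G)
    (hc : IsNCircled G) {f : (Fin n → ℂ) → ℂ} (hf : ContinuousOn f G)
    {a : (Fin n → ℤ) → ℂ} (ha : ∀ α, ∀ z ∈ G ∩ nonvanishing n,
      laurentCoeffFun f α z = a α * laurentMonomial α z) {z : Fin n → ℂ}
    (hz : z ∈ G ∩ nonvanishing n) : Summable fun α => ‖a α * laurentMonomial α z‖ := by
  obtain ⟨ρ, hρ, hmem⟩ := exists_signScale_mem (hG.inter (isOpen_nonvanishing n)) hz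
  have hM : ∀ s : Fin n → Bool, ∃ M, ∀ θ, ‖f (torusPoint θ * signScale ρ s z)‖ ≤ M := by
    intro s
    have hcont : ContinuousOn (fun θ : UnitAddTorus (Fin n) => f (torusPoint θ * signScale ρ s z))
        univ := hf.comp (continuous_torusPoint.mul continuous_const).continuousOn
          fun θ _ => hc.mul_mem (norm_torusPoint θ) (hmem s).1
    obtain ⟨M, hM⟩ := isCompact_univ.exists_bound_of_continuousOn hcont
    exact ⟨M, fun θ => hM θ (mem_univ _)⟩
  choose M hM using hM
  have hbound : ∀ α, ‖a α * laurentMonomial α z‖ ≤ (∑ s, |M s|) * ∏ j, (ρ⁻¹) ^ (α j).natAbs := by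
    intro α
    -- Scaling up where `α j ≥ 0` and down elsewhere multiplies the term by `ρ^(∑ |α j|)`. Only
    -- finitely many scalings occur, so one bound for `f` yields geometric decay.
    set s : Fin n → Bool := fun j => decide (0 ≤ α j)
    have h1 := norm_laurentCoeffFun_le α (hM s)
    rw [ha α _ (hmem s), laurentMonomial_signScale] at h1
    have h2 : M s ≤ ∑ s, |M s| := (le_abs_self _).trans
      (Finset.single_le_sum (f := fun s => |M s|) (fun _ _ => abs_nonneg _) (Finset.mem_univ s))
    have h3 : (∏ j, ρ ^ (α j).natAbs) * ‖a α * laurentMonomial α z‖ ≤ ∑ s, |M s| := by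
      refine le_trans (le_of_eq ?_) (h1.trans h2)
      rw [norm_mul, norm_mul, norm_mul, norm_prod]
      have : ∏ j, ‖(ρ : ℂ) ^ (α j).natAbs‖ = ∏ j, ρ ^ (α j).natAbs :=
        Finset.prod_congr rfl fun j _ => by
          rw [norm_pow, Complex.norm_real, Real.norm_of_nonneg (by linarith)]
      rw [this]; ring
    have hpos : 0 < ∏ j, ρ ^ (α j).natAbs := Finset.prod_pos fun j _ => by positivity
    simp only [inv_pow, Finset.prod_inv_distrib]
    rw [← div_eq_mul_inv, le_div_iff₀ hpos, mul_comm]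
    exact h3
  refine Summable.of_nonneg_of_le (fun _ => norm_nonneg _) hbound (Summable.mul_left _ ?_)
  exact summable_prod_pi_of_nonneg (fun k => by positivity) (summable_zpow_neg_natAbs hρ) n

/-- The Laurent terms at `z` are the Fourier coefficients of `θ ↦ f (e^{2πiθ} z)`; the absolutely
convergent Fourier series is evaluated at `θ = 0`. -/
theorem hasSum_laurent {n : ℕ} {G : Set (Fin n → ℂ)} (hG : IsOpen G)
    (hc : IsNCircled G) {f : (Fin n → ℂ) → ℂ} (hf : ContinuousOn f G)
    {a : (Fin n → ℤ) → ℂ} (ha : ∀ α, ∀ z ∈ G ∩ nonvanishing n,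
      laurentCoeffFun f α z = a α * laurentMonomial α z) {z : Fin n → ℂ}
    (hz : z ∈ G ∩ nonvanishing n) : HasSum (fun α => a α * laurentMonomial α z) (f z) := by
  have hs := summable_laurentCoeff hG hc hf ha hz
  let F : C(UnitAddTorus (Fin n), ℂ) := ⟨fun θ => f (torusPoint θ * z), by
    rw [← continuousOn_univ]
    exact hf.comp (continuous_torusPoint.mul continuous_const).continuousOn
      fun θ _ => hc.mul_mem (norm_torusPoint θ) hz.1⟩
  have hF : UnitAddTorus.mFourierCoeff F = fun α => a α * laurentMonomial α z := by
    ext α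
    rw [← ha α z hz]; rfl
  have hsum := UnitAddTorus.hasSum_mFourier_series_apply_of_summable (f := F)
    (by rw [hF]; exact hs.of_norm) 0
  rw [hF] at hsum
  have h0 : F 0 = f z := by simp [F, torusPoint_zero]
  rw [h0] at hsum
  refine hsum.congr_fun fun α => ?_
  simp [UnitAddTorus.mFourier]

open Topology Filter in
theorem differentiableOn_tsum_laurent {n : ℕ} {U : Set (Fin n → ℂ)} (hU : IsOpen U)
    {a : (Fin n → ℤ) → ℂ}
    (hs : ∀ z ∈ U ∩ nonvanishing n, Summable fun α => ‖a α * laurentMonomial α z‖)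
    (hpos : ∀ p ∈ U, ∀ j, p j = 0 → ∀ α, a α ≠ 0 → 0 ≤ α j) :
    DifferentiableOn ℂ (fun z => ∑' α, a α * laurentMonomial α z) U := by
  intro p hp
  -- Vanishing coordinates of `p` are replaced by a small `t ≠ 0`. Near `p` every term is then
  -- dominated by its value at a sign-scaled copy of `q`; negative exponents occur only where `p j ≠
  -- 0`.
  obtain ⟨q, hq, hqp⟩ : ∃ q ∈ U ∩ nonvanishing n, ∀ j, p j ≠ 0 → q j = p j := by
    have hc : Continuous fun t : ℝ => fun j => if p j = 0 then (t : ℂ) else p j := by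
      refine continuous_pi fun j => ?_
      split_ifs <;> fun_prop
    have h0 : (fun j => if p j = 0 then ((0 : ℝ) : ℂ) else p j) = p := by
      ext j; split_ifs with h <;> simp [h]
    have hev : ∀ᶠ t : ℝ in 𝓝 0, (fun j => if p j = 0 then (t : ℂ) else p j) ∈ U :=
      hc.continuousAt (by simp only [h0]; exact hU.mem_nhds hp)
    obtain ⟨t, htU, ht⟩ := ((hev.filter_mono nhdsWithin_le_nhds).and
      (self_mem_nhdsWithin (s := {(0 : ℝ)}ᶜ))).exists
    refine ⟨_, ⟨htU, fun j => ?_⟩, fun j hj => by simp [hj]⟩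
    by_cases hj : p j = 0
    · simpa [hj] using ht
    · simp [hj]
  obtain ⟨ρ, hρ, hmem⟩ := exists_signScale_mem (hU.inter (isOpen_nonvanishing n)) hq
  have hρ0 : 0 < ρ := by linarith
  set V : Set (Fin n → ℂ) := U ∩ ⋂ j, ({z | ‖z j‖ < ρ * ‖q j‖} ∩
    {z | p j ≠ 0 → ρ⁻¹ * ‖q j‖ < ‖z j‖}) with hV
  have hVo : IsOpen V := by
    refine hU.inter (isOpen_iInter_of_finite fun j => IsOpen.inter ?_ ?_)
    · exact isOpen_lt (by fun_prop) (by fun_prop)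
    · by_cases h : p j = 0
      · simp [h]
      · simp only [ne_eq, h, not_false_eq_true, forall_const]
        exact isOpen_lt (by fun_prop) (by fun_prop)
  have hpV : p ∈ V := by
    refine ⟨hp, mem_iInter.2 fun j => ⟨?_, fun hj => ?_⟩⟩
    · show ‖p j‖ < ρ * ‖q j‖
      have hqj : 0 < ‖q j‖ := norm_pos_iff.2 (hq.2 j)
      by_cases hj : p j = 0
      · rw [hj, norm_zero]; positivity
      · rw [← hqp j hj]; nlinarith
    · rw [← hqp j hj]
      have hqj : 0 < ‖q j‖ := norm_pos_iff.2 (hq.2 j)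
      have : ρ⁻¹ < 1 := inv_lt_one_of_one_lt₀ hρ
      nlinarith
  have hz0 : ∀ z ∈ V, ∀ j, z j = 0 → p j = 0 := by
    intro z hz j hzj
    by_contra h
    have := (mem_iInter.1 hz.2 j).2 h
    rw [hzj, norm_zero] at this
    exact absurd this (not_lt.2 (by positivity))
  have hu : Summable fun α => ∑ s : Fin n → Bool, ‖a α * laurentMonomial α (signScale ρ s q)‖ :=
    summable_sum fun s _ => hs _ (hmem s)
  refine ((differentiableOn_tsum_of_bound hVo hu (F := fun α z => a α * laurentMonomial α z)
    ?_ ?_).differentiableAt (hVo.mem_nhds hpV)).differentiableWithinAt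
  · intro α z hz
    by_cases ha : a α = 0
    · simp only [ha, zero_mul]; exact differentiableWithinAt_const _
    · exact ((differentiableAt_laurentMonomial α fun j hj =>
        hpos p hp j (hz0 z hz j hj) α ha).const_mul (a α)).differentiableWithinAt
  · intro α z hz
    by_cases ha : a α = 0
    · simp [ha]
    refine le_trans ?_ (Finset.single_le_sum
      (f := fun s : Fin n → Bool => ‖a α * laurentMonomial α (signScale ρ s q)‖)
      (fun _ _ => norm_nonneg _) (Finset.mem_univ fun j => decide (0 ≤ α j)))
    rw [norm_mul, norm_mul, norm_laurentMonomial, norm_laurentMonomial]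
    refine mul_le_mul_of_nonneg_left (Finset.prod_le_prod (fun j _ => by positivity)
      fun j _ => ?_) (norm_nonneg _)
    obtain ⟨h1, h2⟩ := mem_iInter.1 hz.2 j
    have hqj : 0 < ‖q j‖ := norm_pos_iff.2 (hq.2 j)
    by_cases hα : 0 ≤ α j
    · have : ‖signScale ρ (fun j => decide (0 ≤ α j)) q j‖ = ρ * ‖q j‖ := by
        simp [signScale, hα, abs_of_pos hρ0]
      rw [this]
      exact zpow_le_zpow_left₀ hα (norm_nonneg _) (le_of_lt h1)
    · have : ‖signScale ρ (fun j => decide (0 ≤ α j)) q j‖ = ρ⁻¹ * ‖q j‖ := by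
        simp [signScale, hα, abs_of_pos hρ0]
      rw [this]
      have hpj : p j ≠ 0 := fun h => hα (hpos p hp j h α ha)
      obtain ⟨k, hk⟩ : ∃ k : ℕ, α j = -(k : ℤ) := ⟨(α j).natAbs, by omega⟩
      rw [hk, zpow_neg, zpow_neg]
      simp only [zpow_natCast]
      have h3 := h2 hpj
      gcongr

-- A negative exponent would make the monomial blow up at least like `1 / t` as the `j`-th
-- coordinate `t` tends to zero. Density moves the other coordinates away from zero first.
open Topology Filter in
theorem nonneg_of_norm_laurentMonomial_le {n : ℕ} {U : Set (Fin n → ℂ)} (hU : IsOpen U)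
    {z : Fin n → ℂ} (hz : z ∈ U) {j : Fin n} (hj : z j = 0) {β : Fin n → ℤ} {M : ℝ}
    (hM : ∀ w ∈ U ∩ nonvanishing n, ‖laurentMonomial β w‖ ≤ M) : 0 ≤ β j := by
  by_contra hβ
  have hWo : IsOpen {w : Fin n → ℂ | Function.update w j 0 ∈ U} :=
    hU.preimage (continuous_id.update j continuous_const)
  obtain ⟨w, hwU, hw⟩ := (dense_nonvanishing n).inter_open_nonempty _ hWo
    ⟨z, by show Function.update z j 0 ∈ U; rwa [← hj, Function.update_eq_self]⟩
  have hcont : Continuous fun t : ℝ => Function.update w j (t : ℂ) :=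
    continuous_const.update j (by fun_prop)
  have hev : ∀ᶠ t : ℝ in 𝓝[>] 0, Function.update w j (t : ℂ) ∈ U := by
    refine Eventually.filter_mono nhdsWithin_le_nhds (hcont.continuousAt ?_)
    simp only [Complex.ofReal_zero]
    exact hU.mem_nhds hwU
  set c : ℝ := ∏ i ∈ Finset.univ.erase j, ‖w i‖ ^ β i with hc
  have hc0 : 0 < c := Finset.prod_pos fun i _ => zpow_pos (norm_pos_iff.2 (hw i)) _
  have hle : ∀ᶠ t : ℝ in 𝓝[>] 0, c ≤ M * t := by
    filter_upwards [hev, self_mem_nhdsWithin, Ioo_mem_nhdsGT (show (0 : ℝ) < 1 by norm_num)]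
      with t htU ht0 ht1
    have ht : 0 < t := ht0
    have h1 := hM _ ⟨htU, fun i => by
      by_cases hi : i = j
      · subst hi; simpa using ht.ne'
      · simpa [hi] using hw i⟩
    rw [norm_laurentMonomial, ← Finset.mul_prod_erase _ _ (Finset.mem_univ j)] at h1
    have h2 : ∏ i ∈ Finset.univ.erase j, ‖Function.update w j (t : ℂ) i‖ ^ β i = c :=
      Finset.prod_congr rfl fun i hi => by rw [Function.update_of_ne (Finset.ne_of_mem_erase hi)]
    rw [h2, Function.update_self, Complex.norm_real, Real.norm_of_nonneg ht.le] at h1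
    have h3 : t⁻¹ ≤ t ^ β j := by
      rw [← zpow_neg_one]
      exact zpow_le_zpow_right_of_le_one₀ ht ht1.2.le (by omega)
    have h4 : t⁻¹ * c ≤ M := (mul_le_mul_of_nonneg_right h3 hc0.le).trans h1
    calc c = t⁻¹ * c * t := by field_simp
      _ ≤ M * t := by gcongr
  have hlim : Tendsto (fun t : ℝ => M * t) (𝓝[>] 0) (𝓝 0) := by
    have : Tendsto (fun t : ℝ => M * t) (𝓝 0) (𝓝 (M * 0)) := by
      exact (continuous_const.mul continuous_id).tendsto 0
    rw [mul_zero] at this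
    exact this.mono_left nhdsWithin_le_nhds
  exact absurd (ge_of_tendsto hlim hle) (not_le.2 hc0)

/-! ### Logarithmic images and extension of bounded functions -/

/-- The vector `(log |z₁|, …, log |zₙ|)`. -/
noncomputable def logAbs {n : ℕ} (z : Fin n → ℂ) : Fin n → ℝ := fun j => Real.log ‖z j‖

/-- The point `(e^{x₁}, …, e^{xₙ})`. -/
noncomputable def expPoint {n : ℕ} (x : Fin n → ℝ) : Fin n → ℂ := fun j => (Real.exp (x j) : ℝ)

theorem expPoint_mem_nonvanishing {n : ℕ} (x : Fin n → ℝ) : expPoint x ∈ nonvanishing n :=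
  fun j => by simp [expPoint]

theorem logAbs_expPoint {n : ℕ} (x : Fin n → ℝ) : logAbs (expPoint x) = x := by
  ext j
  rw [logAbs, expPoint, Complex.norm_real, Real.norm_of_nonneg (Real.exp_pos _).le, Real.log_exp]

theorem mem_logSet_iff {n : ℕ} {G : Set (Fin n → ℂ)} {x : Fin n → ℝ} :
    x ∈ logSet G ↔ expPoint x ∈ G := Iff.rfl

theorem continuous_expPoint {n : ℕ} : Continuous (expPoint (n := n)) := by
  unfold expPoint; fun_prop

theorem norm_expPoint_logAbs {n : ℕ} {z : Fin n → ℂ} (hz : z ∈ nonvanishing n) (j : Fin n) :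
    ‖expPoint (logAbs z) j‖ = ‖z j‖ := by
  rw [expPoint, logAbs, Complex.norm_real, Real.norm_of_nonneg (Real.exp_pos _).le,
    Real.exp_log (norm_pos_iff.2 (hz j))]

theorem IsNCircled.logAbs_mem_iff {n : ℕ} {G : Set (Fin n → ℂ)} (hG : IsNCircled G)
    {z : Fin n → ℂ} (hz : z ∈ nonvanishing n) : logAbs z ∈ logSet G ↔ z ∈ G :=
  ⟨fun h => hG.mem_of_norm_eq (norm_expPoint_logAbs hz) h,
    fun h => hG.mem_of_norm_eq (fun j => (norm_expPoint_logAbs hz j).symm) h⟩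

theorem isOpen_logSet {n : ℕ} {G : Set (Fin n → ℂ)} (hG : IsOpen G) : IsOpen (logSet G) :=
  hG.preimage continuous_expPoint

theorem IsNCircled.nonempty_logSet {n : ℕ} {G : Set (Fin n → ℂ)} (hc : IsNCircled G)
    (hG : IsOpen G) (hne : G.Nonempty) : (logSet G).Nonempty := by
  obtain ⟨z, hzG, hz⟩ := (dense_nonvanishing n).inter_open_nonempty _ hG hne
  exact ⟨_, (hc.logAbs_mem_iff hz).2 hzG⟩

theorem continuousOn_logAbs {n : ℕ} : ContinuousOn (logAbs (n := n)) (nonvanishing n) := by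
  unfold logAbs
  refine continuousOn_pi.2 fun j => ContinuousOn.log (by fun_prop) fun z hz => ?_
  exact norm_ne_zero_iff.2 (hz j)

theorem norm_laurentMonomial_eq_exp {n : ℕ} (α : Fin n → ℤ) {z : Fin n → ℂ}
    (hz : z ∈ nonvanishing n) :
    ‖laurentMonomial α z‖ = Real.exp (∑ j, (α j : ℝ) * logAbs z j) := by
  rw [norm_laurentMonomial, Real.exp_sum]
  refine Finset.prod_congr rfl fun j _ => ?_
  rw [logAbs, mul_comm, Real.exp_mul, Real.exp_log (norm_pos_iff.2 (hz j)), Real.rpow_intCast]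

/-- The logarithmic image of an `n`-circled domain of holomorphy is convex. -/
theorem convex_logSet {n : ℕ} {G : Set (Fin n → ℂ)} (hc : IsNCircled G)
    (hG : IsDomainOfHolomorphy G) : Convex ℝ (logSet G) := by
  obtain ⟨⟨hopen, hconn⟩, hno⟩ := hG
  set X := logSet G with hX
  have hXo : IsOpen X := isOpen_logSet hopen
  have hXn : X.Nonempty := hc.nonempty_logSet hopen hconn.nonempty
  set G₁ : Set (Fin n → ℂ) := nonvanishing n ∩ logAbs ⁻¹' convexHull ℝ X with hG₁
  have hG₁o : IsOpen G₁ :=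
    continuousOn_logAbs.isOpen_inter_preimage (isOpen_nonvanishing n) hXo.convexHull
  have hG₁c : IsConnected G₁ := by
    obtain ⟨x, hx⟩ := hXn
    refine ⟨⟨expPoint x, expPoint_mem_nonvanishing x, ?_⟩, ?_⟩
    · rw [mem_preimage, logAbs_expPoint]; exact subset_convexHull ℝ X hx
    have himg : G₁ = (fun p : (Fin n → ℝ) × (Fin n → ℝ) => fun j =>
        Complex.exp (p.1 j + p.2 j * Complex.I)) '' (convexHull ℝ X ×ˢ univ) := by
      ext z
      constructor
      · rintro ⟨hz, hzX⟩
        refine ⟨(logAbs z, fun j => Complex.arg (z j)), ⟨hzX, mem_univ _⟩, ?_⟩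
        ext j
        simp only [logAbs]
        rw [← Complex.log_re, ← Complex.log_im, Complex.re_add_im, Complex.exp_log (hz j)]
      · rintro ⟨⟨x, θ⟩, ⟨hx, -⟩, rfl⟩
        refine ⟨fun j => Complex.exp_ne_zero _, ?_⟩
        have : logAbs (fun j => Complex.exp (x j + θ j * Complex.I)) = x := by
          ext j
          simp [logAbs, Complex.norm_exp]
        rw [mem_preimage, this]; exact hx
    rw [himg]
    refine IsPreconnected.image ((convex_convexHull ℝ X).isPreconnected.prod isPreconnected_univ)
      _ (Continuous.continuousOn (by fun_prop))
  have hG₀c : IsConnected (G ∩ nonvanishing n) :=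
    ⟨(dense_nonvanishing n).inter_open_nonempty _ hopen hconn.nonempty,
      isPreconnected_inter_nonvanishing hopen hconn.isPreconnected⟩
  -- The Laurent series of each `f` converges over the convex hull of `log G`, because convexity of
  -- `exp` makes the set of absolute convergence convex. So every `f` extends to `G₁`.
  have hsub : G₁ ⊆ G := by
    by_contra hns
    refine hno ⟨G ∩ nonvanishing n, G₁, ⟨hopen.inter (isOpen_nonvanishing n), hG₀c⟩, ⟨hG₁o, hG₁c⟩,
      fun z hz => ⟨hz.1, hz.2, subset_convexHull ℝ X ((hc.logAbs_mem_iff hz.2).2 hz.1)⟩, hns,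
      fun f hf => ?_⟩
    obtain ⟨a, ha⟩ := exists_laurentCoeff hopen hconn.isPreconnected hc hf
    refine ⟨fun z => ∑' α, a α * laurentMonomial α z, ?_, fun z hz =>
      (hasSum_laurent hopen hc hf.continuousOn ha hz).tsum_eq⟩
    refine differentiableOn_tsum_laurent hG₁o (fun z hz => ?_)
      (fun p hp j hj => absurd hj (hp.1 j))
    have hconv : Convex ℝ {x : Fin n → ℝ |
        Summable fun α : Fin n → ℤ => ‖a α‖ * Real.exp (∑ j, (α j : ℝ) * x j)} := by
      intro x hx y hy s t hs ht hst
      refine Summable.of_nonneg_of_le (fun α => by positivity) (fun α => ?_)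
        ((hx.mul_left s).add (hy.mul_left t))
      have h1 : ∑ j, (α j : ℝ) * (s • x + t • y) j =
          s • (∑ j, (α j : ℝ) * x j) + t • ∑ j, (α j : ℝ) * y j := by
        simp only [Pi.add_apply, Pi.smul_apply, smul_eq_mul, Finset.mul_sum,
          ← Finset.sum_add_distrib]
        exact Finset.sum_congr rfl fun j _ => by ring
      rw [h1]
      have h2 := convexOn_exp.2 (mem_univ (∑ j, (α j : ℝ) * x j))
        (mem_univ (∑ j, (α j : ℝ) * y j)) hs ht hst
      have h3 := mul_le_mul_of_nonneg_left h2 (norm_nonneg (a α))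
      refine h3.trans (le_of_eq ?_)
      simp only [smul_eq_mul]
      ring
    have hXs : X ⊆ {x : Fin n → ℝ |
        Summable fun α : Fin n → ℤ => ‖a α‖ * Real.exp (∑ j, (α j : ℝ) * x j)} := by
      intro x hx
      refine (summable_laurentCoeff hopen hc hf.continuousOn ha
        ⟨hx, expPoint_mem_nonvanishing x⟩).congr fun α => ?_
      rw [norm_mul]
      congr 1
      exact (norm_laurentMonomial_eq_exp α (expPoint_mem_nonvanishing x)).trans
        (by rw [logAbs_expPoint])
    refine (convexHull_min hXs hconv hz.1.2).congr fun α => ?_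
    rw [norm_mul, norm_laurentMonomial_eq_exp α hz.2]
  have hhull : convexHull ℝ X ⊆ X := fun x hx => hsub
    ⟨expPoint_mem_nonvanishing x, by
      show logAbs (expPoint x) ∈ convexHull ℝ X
      rw [logAbs_expPoint]
      exact hx⟩
  have := convex_convexHull ℝ X
  rwa [hhull.antisymm (subset_convexHull ℝ X)] at this

/-- An open convex set is the interior of its closure; off the hyperplanes this transfers from `log
G` to `G`. -/
theorem interior_closure_inter_nonvanishing_subset {n : ℕ} {G : Set (Fin n → ℂ)}
    (hc : IsNCircled G) (hopen : IsOpen G) (hconv : Convex ℝ (logSet G)) :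
    interior (closure G) ∩ nonvanishing n ⊆ G := by
  rintro z ⟨hz, hz0⟩
  have hne : G.Nonempty := closure_nonempty_iff.1 ⟨z, interior_subset hz⟩
  have hXo : IsOpen (logSet G) := isOpen_logSet hopen
  have hXn : (logSet G).Nonempty := hc.nonempty_logSet hopen hne
  -- A continuous section of `logAbs` through `z`, keeping the arguments of `z`.
  set w : (Fin n → ℝ) → Fin n → ℂ := fun y j => (Real.exp (y j - logAbs z j) : ℝ) * z j with hw
  have hwc : Continuous w := by fun_prop
  have hw0 : w (logAbs z) = z := by ext j; simp [hw]
  have hwl : ∀ y, w y ∈ nonvanishing n ∧ logAbs (w y) = y := by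
    intro y
    refine ⟨fun j => mul_ne_zero (by simp) (hz0 j), ?_⟩
    ext j
    have : ‖z j‖ ≠ 0 := norm_ne_zero_iff.2 (hz0 j)
    simp only [logAbs, hw, norm_mul, Complex.norm_real, Real.norm_of_nonneg (Real.exp_pos _).le]
    rw [Real.log_mul (Real.exp_ne_zero _) this, Real.log_exp]; ring
  have hmem : logAbs z ∈ interior (closure (logSet G)) := by
    refine mem_interior.2 ⟨w ⁻¹' interior (closure G), ?_, isOpen_interior.preimage hwc, by
      rw [mem_preimage, hw0]; exact hz⟩
    intro y hy
    obtain ⟨hy0, hyl⟩ := hwl y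
    have h1 : w y ∈ closure (nonvanishing n ∩ G) :=
      (isOpen_nonvanishing n).inter_closure ⟨hy0, interior_subset hy⟩
    rw [← hyl]
    have h2 : ContinuousWithinAt logAbs (nonvanishing n ∩ G) (w y) :=
      (continuousOn_logAbs (w y) hy0).mono inter_subset_left
    exact h2.mem_closure h1 fun u hu => (hc.logAbs_mem_iff hu.1).2 hu.2
  rw [hconv.interior_closure_eq_interior_of_nonempty_interior (by rwa [hXo.interior_eq]),
    hXo.interior_eq] at hmem
  exact (hc.logAbs_mem_iff hz0).1 hmem

/-- The new points lie on coordinate hyperplanes. Boundedness of each Laurent term excludes negative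
exponents there, so the series itself is the extension. -/
theorem exists_extension_interior_closure {n : ℕ} {G : Set (Fin n → ℂ)}
    (hc : IsNCircled G) (hopen : IsOpen G) (hconn : IsPreconnected G) (hconv : Convex ℝ (logSet G))
    {f : (Fin n → ℂ) → ℂ} (hf : DifferentiableOn ℂ f G) {M : ℝ} (hM : ∀ z ∈ G, ‖f z‖ ≤ M) :
    ∃ g, DifferentiableOn ℂ g (interior (closure G)) ∧ EqOn g f (G ∩ nonvanishing n) := by
  obtain ⟨a, ha⟩ := exists_laurentCoeff hopen hconn hc hf
  have hsub := interior_closure_inter_nonvanishing_subset hc hopen hconv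
  refine ⟨fun z => ∑' α, a α * laurentMonomial α z, ?_, fun z hz =>
      (hasSum_laurent hopen hc hf.continuousOn ha hz).tsum_eq⟩
  refine differentiableOn_tsum_laurent isOpen_interior
    (fun z hz => summable_laurentCoeff hopen hc hf.continuousOn ha ⟨hsub hz, hz.2⟩) ?_
  intro p hp j hj α hα
  refine nonneg_of_norm_laurentMonomial_le (M := M / ‖a α‖) isOpen_interior hp hj fun w hw => ?_
  rw [le_div_iff₀' (norm_pos_iff.2 hα), ← norm_mul, ← ha α w ⟨hsub hw, hw.2⟩]
  exact norm_laurentCoeffFun_le α fun θ => hM _ (hc.mul_mem (norm_torusPoint θ) (hsub hw))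

/-! ### Functions with bounded first derivatives -/

theorem exists_norm_le_of_memLp_top {n : ℕ} {G : Set (Fin n → ℂ)} (hG : IsOpen G)
    {g : (Fin n → ℂ) → ℂ} (hg : ContinuousOn g G) (hm : MemLp g ∞ (volume.restrict G)) :
    ∃ M : ℝ, ∀ z ∈ G, ‖g z‖ ≤ M := by
  have hfin : eLpNormEssSup g (volume.restrict G) ≠ ∞ := by
    have := hm.2.ne
    rwa [eLpNorm_exponent_top] at this
  refine ⟨(eLpNormEssSup g (volume.restrict G)).toReal, ?_⟩
  set M := (eLpNormEssSup g (volume.restrict G)).toReal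
  have hae := ae_le_eLpNormEssSup (f := g) (μ := volume.restrict G)
  rw [ae_restrict_iff' hG.measurableSet] at hae
  have hopen : IsOpen (G ∩ g ⁻¹' {w | M < ‖w‖}) :=
    hg.isOpen_inter_preimage hG (isOpen_lt continuous_const continuous_norm)
  -- By continuity the set exceeding the essential supremum is open; being null, it is empty.
  have hnull : volume (G ∩ g ⁻¹' {w | M < ‖w‖}) = 0 := by
    rw [← nonpos_iff_eq_zero, ← ae_iff.1 hae]
    refine measure_mono fun z hz h => absurd (h hz.1) (not_le.2 ?_)
    have h2 : M < ‖g z‖ := hz.2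
    rw [← ENNReal.ofReal_toReal hfin, ← ofReal_norm]
    exact (ENNReal.ofReal_lt_ofReal_iff (ENNReal.toReal_nonneg.trans_lt h2)).2 h2
  rw [hopen.measure_eq_zero_iff volume] at hnull
  intro z hz
  by_contra h
  have : z ∈ G ∩ g ⁻¹' {w | M < ‖w‖} := ⟨hz, not_le.1 h⟩
  rw [hnull] at this
  exact this

theorem multiPartial_zero {n : ℕ} (f : (Fin n → ℂ) → ℂ) : multiPartial 0 f = f := by
  unfold multiPartial
  generalize List.finRange n = l
  induction l with
  | nil => rfl
  | cons a l _ => simp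

theorem multiPartial_single {n : ℕ} (j : Fin n) (f : (Fin n → ℂ) → ℂ) :
    multiPartial (Pi.single j 1) f = cpartial j f := by
  have key : ∀ l : List (Fin n), l.Nodup →
      l.foldr (fun i g => (cpartial i)^[(Pi.single j 1 : Fin n → ℕ) i] g) f =
        if j ∈ l then cpartial j f else f := by
    intro l hl
    induction l with
    | nil => simp
    | cons a l ih =>
      rw [List.nodup_cons] at hl
      rw [List.foldr_cons, ih hl.2]
      by_cases h : a = j
      · subst h
        simp [hl.1]
      · have h' : j ≠ a := fun h' => h h'.symm
        simp [h, h']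
  exact (key _ (List.nodup_finRange n)).trans (by simp)

theorem exists_bounds_of_mem_hInfty_one {n : ℕ} {G : Set (Fin n → ℂ)} (hG : IsOpen G)
    {f : (Fin n → ℂ) → ℂ} (hf : f ∈ hInfty 1 G) :
    (∃ M : ℝ, ∀ z ∈ G, ‖f z‖ ≤ M) ∧
      ∀ j, ∃ M : ℝ, ∀ z ∈ G, ‖fderiv ℂ f z (Pi.single j 1)‖ ≤ M := by
  obtain ⟨hd, hm⟩ := hf
  have hd' : DifferentiableOn ℂ f G := hd
  refine ⟨exists_norm_le_of_memLp_top hG hd'.continuousOn ?_, fun j => ?_⟩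
  · have := hm 0 (by simp)
    rwa [multiPartial_zero] at this
  · refine exists_norm_le_of_memLp_top (g := cpartial j f) hG ?_ ?_
    · exact (continuousOn_fderiv_of_differentiableOn hG hd').clm_apply continuousOn_const
    · have := hm (Pi.single j 1) (by simp)
      rwa [multiPartial_single] at this

theorem add_smul_mem_of_mem_linealitySpace {n : ℕ} {X : Set (Fin n → ℝ)} {v x : Fin n → ℝ}
    (hv : v ∈ linealitySpace X) (hx : x ∈ X) (s : ℝ) : x + s • v ∈ X := by
  have h : X + (linealitySpace X : Set (Fin n → ℝ)) = X := (linealitySpace_isGreatest X).1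
  rw [← h]
  exact add_mem_add hx ((linealitySpace X).smul_mem s hv)

theorem eq_zero_of_forall_mul_le {a b : ℝ} {c : ℝ} (h : ∀ s : ℝ, a + s * b ≤ c) : b = 0 := by
  by_contra hb
  have := h ((c - a + 1) / b)
  rw [div_mul_cancel₀ _ hb] at this
  linarith

theorem cpartial_laurentMonomial {n : ℕ} (α : Fin n → ℤ) (j : Fin n) {z : Fin n → ℂ}
    (hz : ∀ i, z i = 0 → 0 ≤ α i) :
    cpartial j (laurentMonomial α) z = (α j : ℂ) * laurentMonomial (α - Pi.single j 1) z := by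
  have h1 := (differentiableAt_laurentMonomial α hz).hasFDerivAt
  have h2 : HasDerivAt (fun t : ℂ => z + t • (Pi.single j 1 : Fin n → ℂ)) (Pi.single j 1) 0 := by
    simpa using ((hasDerivAt_id (0 : ℂ)).smul_const (Pi.single j 1 : Fin n → ℂ)).const_add z
  have h3 : HasDerivAt (laurentMonomial α ∘ fun t : ℂ => z + t • (Pi.single j 1 : Fin n → ℂ))
      (cpartial j (laurentMonomial α) z) 0 :=
    HasFDerivAt.comp_hasDerivAt 0 (by simpa using h1) h2
  have h4 : (laurentMonomial α ∘ fun t : ℂ => z + t • (Pi.single j 1 : Fin n → ℂ)) =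
      fun t : ℂ => (z j + t) ^ α j * ∏ i ∈ Finset.univ.erase j, z i ^ α i := by
    ext t
    simp only [Function.comp_apply, laurentMonomial]
    rw [← Finset.mul_prod_erase _ _ (Finset.mem_univ j)]
    congr 1
    · simp
    · refine Finset.prod_congr rfl fun i hi => ?_
      simp [Finset.ne_of_mem_erase hi]
  rw [h4] at h3
  have h5 : HasDerivAt (fun t : ℂ => (z j + t) ^ α j) ((α j : ℂ) * z j ^ (α j - 1)) 0 := by
    have h6 : HasDerivAt (fun w : ℂ => w ^ α j) ((α j : ℂ) * (z j + 0) ^ (α j - 1)) (z j + 0) :=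
      hasDerivAt_zpow _ _ (by
        rw [add_zero]
        by_cases h : z j = 0
        · exact Or.inr (hz j h)
        · exact Or.inl h)
    have h7 := h6.comp_const_add (z j) 0
    simpa using h7
  rw [h3.unique (h5.mul_const _), mul_assoc]
  congr 1
  rw [laurentMonomial, ← Finset.mul_prod_erase _ _ (Finset.mem_univ j)]
  congr 1
  · simp
  · exact Finset.prod_congr rfl fun i hi => by simp [Finset.ne_of_mem_erase hi]

/-- A nonzero Laurent coefficient of a function in `𝓗^{∞,1}(G)` has an exponent which vanishes in
every coordinate direction not orthogonal to `𝓔(log G)`. -/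
theorem exponent_eq_zero_of_mem_hInfty_one {n : ℕ} {G : Set (Fin n → ℂ)} (hc : IsNCircled G)
    (hG : IsOpen G) (hne : G.Nonempty) {f : (Fin n → ℂ) → ℂ} (hf : f ∈ hInfty 1 G)
    {a : (Fin n → ℤ) → ℂ} (ha : ∀ α, ∀ z ∈ G ∩ nonvanishing n,
      laurentCoeffFun f α z = a α * laurentMonomial α z) {α : Fin n → ℤ} (hα : a α ≠ 0)
    {j : Fin n} {v : Fin n → ℝ} (hv : v ∈ linealitySpace (logSet G)) (hvj : v j ≠ 0) :
    α j = 0 := by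
  by_contra hαj
  obtain ⟨⟨M, hM⟩, hM'⟩ := exists_bounds_of_mem_hInfty_one hG hf
  obtain ⟨M', hM'⟩ := hM' j
  obtain ⟨x, hx⟩ := hc.nonempty_logSet hG hne
  have hd : DifferentiableOn ℂ f G := hf.1
  have hopen := hG.inter (isOpen_nonvanishing n)
  -- On the line `x + s v` inside `log G`, the logarithm of `|z^β|` is affine in `s`; being bounded
  -- above, it has slope zero.
  have hdir : ∀ (β : Fin n → ℤ) (b : ℝ), 0 < b → ∀ B : ℝ,
      (∀ z ∈ G ∩ nonvanishing n, b * ‖laurentMonomial β z‖ ≤ B) → ∑ i, (β i : ℝ) * v i = 0 := by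
    intro β b hb B hB
    refine eq_zero_of_forall_mul_le (a := ∑ i, (β i : ℝ) * x i) (c := B / b) fun s => ?_
    have h1 := hB (expPoint (x + s • v)) ⟨add_smul_mem_of_mem_linealitySpace hv hx s,
      expPoint_mem_nonvanishing _⟩
    rw [norm_laurentMonomial_eq_exp β (expPoint_mem_nonvanishing _), logAbs_expPoint,
      ← le_div_iff₀' hb] at h1
    have h2 := Real.add_one_le_exp (∑ j, (β j : ℝ) * (x + s • v) j)
    have h3 : ∑ i, (β i : ℝ) * x i + s * ∑ i, (β i : ℝ) * v i =
        ∑ j, (β j : ℝ) * (x + s • v) j := by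
      rw [Finset.mul_sum, ← Finset.sum_add_distrib]
      exact Finset.sum_congr rfl fun i _ => by simp; ring
    linarith
  have h1 := hdir α ‖a α‖ (norm_pos_iff.2 hα) M fun z hz => by
    rw [← norm_mul, ← ha α z hz]
    exact norm_laurentCoeffFun_le α fun θ => hM _ (hc.mul_mem (norm_torusPoint θ) hz.1)
  have h2 := hdir (α - Pi.single j 1) (‖a α‖ * ‖(α j : ℂ)‖)
    (mul_pos (norm_pos_iff.2 hα) (norm_pos_iff.2 (by exact_mod_cast hαj))) M' fun z hz => by
    have h3 := norm_fderiv_laurentCoeffFun_single_le hG hc hd α hM' hz.1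
    have h4 : fderiv ℂ (laurentCoeffFun f α) z = fderiv ℂ (fun z => a α * laurentMonomial α z) z :=
      Filter.EventuallyEq.fderiv_eq (Filter.eventuallyEq_of_mem (hopen.mem_nhds hz) (ha α))
    rw [h4, fderiv_const_mul (differentiableAt_laurentMonomial α fun i hi => absurd hi (hz.2 i))]
      at h3
    have h5 := cpartial_laurentMonomial α j fun i hi => absurd hi (hz.2 i)
    unfold cpartial at h5
    rw [FunLike.coe_smul, Pi.smul_apply, h5, smul_eq_mul, ← mul_assoc, norm_mul, norm_mul] at h3
    exact h3
  have h3 : ∑ i, (((α - Pi.single j 1 : Fin n → ℤ) i : ℤ) : ℝ) * v i = ∑ i, (α i : ℝ) * v i - v j := by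
    have : ∀ i, (((α - Pi.single j 1 : Fin n → ℤ) i : ℤ) : ℝ) * v i = (α i : ℝ) * v i - (if i = j then v i else 0) := by
      intro i
      by_cases h : i = j
      · subst h; simp; ring
      · simp [h]
    rw [Finset.sum_congr rfl fun i _ => this i, Finset.sum_sub_distrib]
    simp
  rw [h3, h1] at h2
  exact hvj (by linarith)

open Filter Topology in
/-- A function in `𝓗^{∞,1}(G)` depends only on the coordinates orthogonal to `𝓔(log G)`. -/
theorem eq_of_mem_hInfty_one {n : ℕ} {G : Set (Fin n → ℂ)} (hc : IsNCircled G)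
    (hG : IsOpen G) (hconn : IsConnected G) {f : (Fin n → ℂ) → ℂ} (hf : f ∈ hInfty 1 G)
    {z w : Fin n → ℂ} (hz : z ∈ G) (hw : w ∈ G)
    (hzw : ∀ j, (∀ v ∈ linealitySpace (logSet G), v j = 0) → z j = w j) : f z = f w := by
  have hd : DifferentiableOn ℂ f G := hf.1
  obtain ⟨a, ha⟩ := exists_laurentCoeff hG hconn.isPreconnected hc hd
  have hstar : ∀ z ∈ G ∩ nonvanishing n, ∀ w ∈ G ∩ nonvanishing n,
      (∀ j, (∀ v ∈ linealitySpace (logSet G), v j = 0) → z j = w j) → f z = f w := by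
    intro z hz w hw hzw
    rw [← (hasSum_laurent hG hc hd.continuousOn ha hz).tsum_eq,
      ← (hasSum_laurent hG hc hd.continuousOn ha hw).tsum_eq]
    refine tsum_congr fun α => ?_
    by_cases hα : a α = 0
    · simp [hα]
    congr 1
    refine Finset.prod_congr rfl fun j _ => ?_
    by_cases hj : ∀ v ∈ linealitySpace (logSet G), v j = 0
    · rw [hzw j hj]
    · push Not at hj
      obtain ⟨v, hv, hvj⟩ := hj
      rw [exponent_eq_zero_of_mem_hInfty_one hc hG hconn.nonempty hf ha hα hv hvj, zpow_zero,
        zpow_zero]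
  -- Adding the same small `t ≠ 0` to all coordinates leaves the hyperplanes and preserves the
  -- equalities `z j = w j`, reducing the claim to nonvanishing points.
  have hshift : ∀ u ∈ G, Tendsto (fun t : ℂ => u + fun _ => t) (𝓝[≠] 0) (𝓝 u) := by
    intro u _
    have : Tendsto (fun t : ℂ => u + fun _ => t) (𝓝 0) (𝓝 (u + fun _ => 0)) :=
      Continuous.tendsto (by fun_prop) 0
    have h0 : (u + fun _ => 0) = u := by ext; simp
    rw [h0] at this
    exact this.mono_left nhdsWithin_le_nhds
  have hnv : ∀ u : Fin n → ℂ, ∀ᶠ t : ℂ in 𝓝[≠] 0, (u + fun _ => t) ∈ nonvanishing n := by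
    intro u
    refine eventually_all.2 fun j => ?_
    by_cases hj : u j = 0
    · filter_upwards [self_mem_nhdsWithin] with t ht
      simpa [hj] using ht
    · have : ∀ᶠ t : ℂ in 𝓝 0, u j + t ≠ 0 :=
        ContinuousAt.eventually_ne (by fun_prop) (by simpa using hj)
      exact this.filter_mono nhdsWithin_le_nhds
  have hlim : ∀ u ∈ G, Tendsto (fun t : ℂ => f (u + fun _ => t)) (𝓝[≠] 0) (𝓝 (f u)) :=
    fun u hu => (hd.continuousOn.continuousAt (hG.mem_nhds hu)).tendsto.comp (hshift u hu)
  refine tendsto_nhds_unique (hlim z hz) ((hlim w hw).congr' ?_)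
  filter_upwards [hnv z, hnv w, (hshift z hz).eventually (hG.mem_nhds hz),
    (hshift w hw).eventually (hG.mem_nhds hw)] with t h1 h2 h3 h4
  exact (hstar _ ⟨h3, h1⟩ _ ⟨h4, h2⟩ fun j hj => by simp [hzw j hj]).symm

/-! ### Coordinate projections and the implication (ii) to (i) -/

/-- The projection `z ↦ z ∘ s` of `ℂⁿ` to the coordinates listed by `s`. -/
noncomputable def coordProj {m n : ℕ} (s : Fin m → Fin n) : (Fin n → ℂ) →L[ℂ] (Fin m → ℂ) :=
  ContinuousLinearMap.pi fun i => ContinuousLinearMap.proj (s i)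

/-- The inclusion of `ℂᵐ` in `ℂⁿ` with the coordinates listed by `s`, by extension by zero. -/
noncomputable def coordIncl {m n : ℕ} (s : Fin m → Fin n) : (Fin m → ℂ) →L[ℂ] (Fin n → ℂ) :=
  LinearMap.toContinuousLinearMap (Function.ExtendByZero.linearMap ℂ s)

theorem coordProj_apply {m n : ℕ} (s : Fin m → Fin n) (z : Fin n → ℂ) (i : Fin m) :
    coordProj s z i = z (s i) := rfl

theorem coordProj_coordIncl {m n : ℕ} {s : Fin m → Fin n} (hs : Function.Injective s)
    (u : Fin m → ℂ) : coordProj s (coordIncl s u) = u := by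
  ext i
  show Function.extend s u 0 (s i) = u i
  exact hs.extend_apply _ _ _

theorem surjective_coordProj {m n : ℕ} {s : Fin m → Fin n} (hs : Function.Injective s) :
    Function.Surjective (coordProj s) := fun u => ⟨_, coordProj_coordIncl hs u⟩

theorem isOpenMap_coordProj {m n : ℕ} {s : Fin m → Fin n} (hs : Function.Injective s) :
    IsOpenMap (coordProj s) :=
  (coordProj s).isOpenMap (surjective_coordProj hs)

theorem IsCDomain.coordProj_preimage {m n : ℕ} {s : Fin m → Fin n} (hs : Function.Injective s)
    {D : Set (Fin m → ℂ)} (hD : IsCDomain D) : IsCDomain (coordProj s ⁻¹' D) := by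
  refine ⟨hD.1.preimage (coordProj s).continuous, ?_, ?_⟩
  · obtain ⟨u, hu⟩ := hD.2.nonempty
    exact ⟨coordIncl s u, by rwa [mem_preimage, coordProj_coordIncl hs]⟩
  -- The map overwrites the coordinates of `w` listed by `s` with those of `u`.
  · have himg : coordProj s ⁻¹' D = (fun p : (Fin m → ℂ) × (Fin n → ℂ) =>
        p.2 + coordIncl s (p.1 - coordProj s p.2)) '' (D ×ˢ univ) := by
      ext z
      constructor
      · intro hz
        exact ⟨(coordProj s z, z), ⟨hz, mem_univ _⟩, by simp⟩
      · rintro ⟨⟨u, w⟩, ⟨hu, -⟩, rfl⟩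
        rw [mem_preimage, map_add, coordProj_coordIncl hs, add_sub_cancel]
        exact hu
    rw [himg]
    exact (hD.2.isPreconnected.prod isPreconnected_univ).image _
      (Continuous.continuousOn (by fun_prop))

theorem IsDomainOfHolomorphyFor.mono {n : ℕ} {𝓕 𝓖 : Set ((Fin n → ℂ) → ℂ)} {G : Set (Fin n → ℂ)}
    (hG : IsDomainOfHolomorphyFor 𝓕 G) (h : 𝓕 ⊆ 𝓖) : IsDomainOfHolomorphyFor 𝓖 G :=
  ⟨hG.1, fun ⟨G₀, G₁, h₀, h₁, hs, hn, he⟩ =>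
    hG.2 ⟨G₀, G₁, h₀, h₁, hs, hn, fun f hf => he f (h hf)⟩⟩

theorem IsDomainOfHolomorphyFor.isFat_of_hInfty_one {n : ℕ} {G : Set (Fin n → ℂ)}
    (hc : IsNCircled G) (hG : IsDomainOfHolomorphyFor (hInfty 1 G) G)
    (hconv : Convex ℝ (logSet G)) : IsFat G := by
  obtain ⟨⟨hopen, hconn⟩, hno⟩ := hG
  have hsub : G ⊆ interior (closure G) := interior_maximal subset_closure hopen
  refine hsub.antisymm ?_
  by_contra hns
  refine hno ⟨G ∩ nonvanishing n, interior (closure G), ⟨hopen.inter (isOpen_nonvanishing n),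
    (dense_nonvanishing n).inter_open_nonempty _ hopen hconn.nonempty,
    isPreconnected_inter_nonvanishing hopen hconn.isPreconnected⟩,
    ⟨isOpen_interior, hconn.nonempty.mono hsub,
      hconn.isPreconnected.subset_closure hsub interior_subset⟩,
    fun z hz => ⟨hz.1, hsub hz.1⟩, hns, fun f hf => ?_⟩
  obtain ⟨⟨M, hM⟩, -⟩ := exists_bounds_of_mem_hInfty_one hopen hf
  obtain ⟨g, hg, hgf⟩ := exists_extension_interior_closure hc hopen hconn.isPreconnected hconv
    hf.1 hM
  exact ⟨g, hg, hgf⟩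

/-- An `𝓗^{∞,1}`-domain of holomorphy is a cylinder over the coordinates orthogonal to
`𝓔(log G)`. -/
theorem IsDomainOfHolomorphyFor.mem_of_hInfty_one {n : ℕ} {G : Set (Fin n → ℂ)}
    (hc : IsNCircled G) (hG : IsDomainOfHolomorphyFor (hInfty 1 G) G)
    {m : ℕ} {s : Fin m → Fin n} (hs : Function.Injective s)
    (hrange : ∀ j, j ∈ range s ↔ ∀ v ∈ linealitySpace (logSet G), v j = 0) :
    coordProj s ⁻¹' (coordProj s '' G) ⊆ G := by
  obtain ⟨⟨hopen, hconn⟩, hno⟩ := hG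
  have hdom : IsCDomain (coordProj s '' G) :=
    ⟨isOpenMap_coordProj hs _ hopen, hconn.image _ (coordProj s).continuous.continuousOn⟩
  have hsub : G ⊆ coordProj s ⁻¹' (coordProj s '' G) := subset_preimage_image _ _
  by_contra hns
  refine hno ⟨G, _, ⟨hopen, hconn⟩, hdom.coordProj_preimage hs, fun z hz => ⟨hz, hsub hz⟩, hns,
    fun f hf => ?_⟩
  have hinv : ∀ z ∈ G, ∀ w ∈ G, coordProj s z = coordProj s w → f z = f w := by
    intro z hz w hw hzw
    refine eq_of_mem_hInfty_one hc hopen hconn hf hz hw fun j hj => ?_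
    obtain ⟨i, rfl⟩ := (hrange j).2 hj
    exact congr_fun hzw i
  classical
  -- The value of `f` at any point of `G` in the same fibre; the default 0 is never used on the
  -- cylinder. Near each point of the cylinder `g` is a translate of `f`, hence holomorphic.
  set g : (Fin n → ℂ) → ℂ := fun z =>
    if h : ∃ w ∈ G, coordProj s w = coordProj s z then f h.choose else 0 with hg
  have hgf : ∀ z, ∀ w ∈ G, coordProj s w = coordProj s z → g z = f w := by
    intro z w hw hwz
    have h : ∃ w ∈ G, coordProj s w = coordProj s z := ⟨w, hw, hwz⟩
    rw [hg]
    simp only [h, dif_pos]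
    exact hinv _ h.choose_spec.1 _ hw (h.choose_spec.2.trans hwz.symm)
  refine ⟨g, fun z hz => ?_, fun z hz => hgf z z hz rfl⟩
  obtain ⟨w, hw, hwz⟩ := hz
  have hev : g =ᶠ[nhds z] fun ζ => f (ζ + (w - z)) := by
    have hcont : ContinuousAt (fun ζ => ζ + (w - z)) z := by fun_prop
    have : ∀ᶠ ζ in nhds z, ζ + (w - z) ∈ G :=
      hcont (by simpa using hopen.mem_nhds hw)
    filter_upwards [this] with ζ hζ
    exact hgf ζ _ hζ (by rw [map_add, map_sub, hwz, sub_self, add_zero])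
  have hd : DifferentiableOn ℂ f G := hf.1
  have h1 : DifferentiableAt ℂ f (z + (w - z)) := by
    rw [add_sub_cancel]; exact hd.differentiableAt (hopen.mem_nhds hw)
  have h2 : DifferentiableAt ℂ (fun ζ => f (ζ + (w - z))) z := h1.comp z (by fun_prop)
  exact (h2.congr_of_eventuallyEq hev).differentiableWithinAt

theorem exists_perm_range {n : ℕ} (J : Finset (Fin n)) (hm : J.card ≤ n) :
    ∃ σ : Equiv.Perm (Fin n), range (fun i : Fin J.card => σ (Fin.castLE hm i)) = ↑J := by
  classical
  have hcard : Fintype.card {i : Fin n // (i : ℕ) < J.card} = Fintype.card {i // i ∈ J} := by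
    rw [Fintype.card_coe, Fintype.card_congr (Fin.castLEquiv hm).symm, Fintype.card_fin]
  let e := Fintype.equivOfCardEq hcard
  refine ⟨e.extendSubtype, ?_⟩
  ext j
  constructor
  · rintro ⟨i, rfl⟩
    exact e.extendSubtype_mem _ i.2
  · intro hj
    refine ⟨⟨(e.symm ⟨j, hj⟩ : Fin n), (e.symm ⟨j, hj⟩).2⟩, ?_⟩
    have : Fin.castLE hm ⟨(e.symm ⟨j, hj⟩ : Fin n), (e.symm ⟨j, hj⟩).2⟩ =
      (e.symm ⟨j, hj⟩ : Fin n) := rfl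
    simp only [this]
    rw [e.extendSubtype_apply_of_mem _ (e.symm ⟨j, hj⟩).2]
    simp

theorem isFatPointedTimesAffine_of_hInfty_one {n : ℕ} {G : Set (Fin n → ℂ)} (hc : IsNCircled G)
    (hhol : IsDomainOfHolomorphy G) (hG : IsDomainOfHolomorphyFor (hInfty 1 G) G) :
    IsFatPointedTimesAffine G := by
  classical
  obtain ⟨hopen, hconn⟩ := hG.1
  set J : Finset (Fin n) :=
    Finset.univ.filter fun j => ∀ v ∈ linealitySpace (logSet G), v j = 0 with hJ
  have hm : J.card ≤ n := by simpa using J.card_le_univ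
  obtain ⟨σ, hσ⟩ := exists_perm_range J hm
  set s : Fin J.card → Fin n := fun i => σ (Fin.castLE hm i) with hs
  have hsi : Function.Injective s := σ.injective.comp (Fin.castLE_injective hm)
  have hrange : ∀ j, j ∈ range s ↔ ∀ v ∈ linealitySpace (logSet G), v j = 0 := by
    intro j; rw [hσ]; simp [hJ]
  set D := coordProj s '' G with hD
  have hGD : G = coordProj s ⁻¹' D :=
    (subset_preimage_image _ _).antisymm (hG.mem_of_hInfty_one hc hsi hrange)
  have hDo : IsOpen D := isOpenMap_coordProj hsi _ hopen
  refine ⟨J.card, hm, σ, D, ?_, ?_, ?_, ?_, hGD⟩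
  · have hfat := hG.isFat_of_hInfty_one hc (convex_logSet hc hhol)
    -- Preimages under an open continuous map commute with interior and closure, so fatness descends
    -- from `G` to `D`.
    have h1 : coordProj s ⁻¹' D = coordProj s ⁻¹' interior (closure D) := by
      rw [(isOpenMap_coordProj hsi).preimage_interior_eq_interior_preimage (coordProj s).continuous,
        (isOpenMap_coordProj hsi).preimage_closure_eq_closure_preimage (coordProj s).continuous,
        ← hGD]
      exact hfat
    exact (surjective_coordProj hsi).preimage_injective h1
  · rintro _ ⟨z, hz, rfl⟩ θ
    refine ⟨fun j => Complex.exp (Complex.I * (Function.extend s θ 0 j : ℝ)) * z j,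
      hc z hz _, ?_⟩
    ext i
    rw [coordProj_apply, coordProj_apply, hsi.extend_apply]
  · refine ⟨⟨hDo, hconn.image _ (coordProj s).continuous.continuousOn⟩, ?_⟩
    rintro ⟨D₀, D₁, h₀, h₁, hsub, hns, hext⟩
    refine hG.2 ⟨coordProj s ⁻¹' D₀, coordProj s ⁻¹' D₁, h₀.coordProj_preimage hsi,
      h₁.coordProj_preimage hsi, ?_, ?_, fun f hf => ?_⟩
    · rw [hGD]; exact preimage_mono hsub
    · rw [hGD, (surjective_coordProj hsi).preimage_subset_preimage_iff]; exact hns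
    have hmem : ∀ u ∈ D, coordIncl s u ∈ G := fun u hu => by
      rw [hGD, mem_preimage, coordProj_coordIncl hsi]; exact hu
    have hfd : DifferentiableOn ℂ f G := hf.1
    obtain ⟨g, hg, hgf⟩ := hext (fun u => f (coordIncl s u))
      (hfd.comp (coordIncl s).differentiable.differentiableOn hmem)
    have hgd : DifferentiableOn ℂ g D₁ := hg
    refine ⟨fun z => g (coordProj s z),
      hgd.comp (coordProj s).differentiable.differentiableOn fun z hz => hz, fun z hz => ?_⟩
    have hzD : coordProj s z ∈ D := (hsub hz).1
    refine (hgf hz).trans (eq_of_mem_hInfty_one hc hopen hconn hf (hmem _ hzD)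
      (by rw [hGD]; exact hzD) fun j hj => ?_)
    obtain ⟨i, rfl⟩ := (hrange j).2 hj
    exact congr_fun (coordProj_coordIncl hsi (coordProj s z)) i
  · rw [eq_bot_iff]
    intro u hu
    let P : (Fin n → ℝ) →ₗ[ℝ] (Fin J.card → ℝ) := LinearMap.funLeft ℝ ℝ s
    have hlog : ∀ x, x ∈ logSet G ↔ P x ∈ logSet D := by
      intro x
      rw [mem_logSet_iff, hGD]; rfl
    -- Since `log G` is the preimage of `log D` under `P`, the extension of `u` by zero belongs to
    -- `𝓔(log G)`, where the coordinates listed by `s` vanish.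
    have hF : (linealitySpace (logSet D)).comap P ≤ linealitySpace (logSet G) := by
      refine (linealitySpace_isGreatest (logSet G)).2 ?_
      refine Subset.antisymm ?_ fun x hx => ⟨x, hx, 0, Submodule.zero_mem _, add_zero x⟩
      rintro _ ⟨x, hx, v, hv, rfl⟩
      rw [hlog] at hx
      show x + v ∈ logSet G
      rw [hlog, map_add]
      simpa using add_smul_mem_of_mem_linealitySpace hv hx 1
    have hv : Function.extend s u 0 ∈ linealitySpace (logSet G) := hF (by
      rw [Submodule.mem_comap]
      have : P (Function.extend s u 0) = u := by
        ext i; exact hsi.extend_apply _ _ _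
      rwa [this])
    rw [Submodule.mem_bot]
    ext i
    have := (hrange (s i)).1 ⟨i, rfl⟩ _ hv
    rwa [hsi.extend_apply] at this

/-! ### Decaying functionals on convex sets without lines -/

theorem exists_dotProduct_eq {m : ℕ} (f : (Fin m → ℝ) →ₗ[ℝ] ℝ) :
    ∃ b : Fin m → ℝ, ∀ x, f x = dotProduct b x := by
  refine ⟨fun j => f (Pi.single j 1), fun x => ?_⟩
  conv_lhs => rw [← Finset.univ_sum_single x]
  rw [map_sum, dotProduct]
  refine Finset.sum_congr rfl fun j _ => ?_
  have : (Pi.single j (x j) : Fin m → ℝ) = x j • Pi.single j 1 := by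
    ext i
    by_cases h : i = j
    · subst h; simp
    · simp [h]
  rw [this, map_smul, smul_eq_mul, mul_comm]

/-- An open convex set without lines has a linear functional tending to `-∞` on it at least as fast
as the norm. -/
theorem exists_dotProduct_le_sub_norm {m : ℕ} {X : Set (Fin m → ℝ)} (hX : IsOpen X)
    (hconv : Convex ℝ X) (hlin : linealitySpace X = ⊥) :
    ∃ (γ : Fin m → ℝ) (C : ℝ), ∀ x ∈ X, dotProduct γ x ≤ C - ‖x‖ := by
  -- If the functionals bounded above on `X` did not span, some `v ≠ 0` would be orthogonal to all
  -- of them, and by Hahn-Banach no translate along `v` could leave `X`.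
  set B : Set (Fin m → ℝ) := {b | ∃ c : ℝ, ∀ x ∈ X, dotProduct b x ≤ c} with hB
  have hspan : Submodule.span ℝ B = ⊤ := by
    by_contra hlt
    obtain ⟨f, hf0, hf⟩ := Submodule.exists_le_ker_of_lt_top _ (lt_top_iff_ne_top.2 hlt)
    obtain ⟨v, hv⟩ := exists_dotProduct_eq f
    have hline : Submodule.span ℝ {v} ≤ linealitySpace X := by
      refine (linealitySpace_isGreatest X).2 ?_
      refine Subset.antisymm ?_ fun x hx => ⟨x, hx, 0, Submodule.zero_mem _, add_zero x⟩
      rintro _ ⟨x, hx, w, hw, rfl⟩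
      obtain ⟨s, rfl⟩ := Submodule.mem_span_singleton.1 hw
      show x + s • v ∈ X
      by_contra hnot
      obtain ⟨g, hg⟩ := geometric_hahn_banach_open_point hconv hX hnot
      obtain ⟨b, hb⟩ := exists_dotProduct_eq (g : (Fin m → ℝ) →ₗ[ℝ] ℝ)
      have hbB : b ∈ B := ⟨g (x + s • v), fun y hy => by
        rw [← hb y]; exact (hg y hy).le⟩
      have h0 : f b = 0 := hf (Submodule.subset_span hbB)
      have h1 : g v = 0 := by
        rw [hv, dotProduct_comm, ← hb] at h0; exact h0
      have h2 := hg x hx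
      rw [map_add, map_smul, h1, smul_zero, add_zero] at h2
      exact lt_irrefl _ h2
    have hv0 : v = 0 := by
      have := hline (Submodule.mem_span_singleton_self v)
      rwa [hlin, Submodule.mem_bot] at this
    exact hf0 (LinearMap.ext fun x => by rw [hv, hv0, zero_dotProduct]; rfl)
  have hP : ∀ w ∈ Submodule.span ℝ B, ∃ (γ : Fin m → ℝ) (C : ℝ), ∀ x ∈ X,
      |dotProduct w x| ≤ C - dotProduct γ x := by
    intro w hw
    induction hw using Submodule.span_induction with
    | mem b hb =>
      obtain ⟨c, hc⟩ := hb
      refine ⟨b, 2 * |c|, fun x hx => ?_⟩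
      have h1 := hc x hx
      have h2 := le_abs_self c
      have h3 := abs_nonneg c
      rw [abs_le]
      constructor <;> linarith
    | zero => exact ⟨0, 0, fun x _ => by simp⟩
    | add u v _ _ hu hv =>
      obtain ⟨γ, C, h⟩ := hu
      obtain ⟨δ, D, h'⟩ := hv
      refine ⟨γ + δ, C + D, fun x hx => ?_⟩
      rw [add_dotProduct, add_dotProduct]
      have h1 := abs_add_le (dotProduct u x) (dotProduct v x)
      have h2 := h x hx
      have h3 := h' x hx
      linarith
    | smul a u _ hu =>
      obtain ⟨γ, C, h⟩ := hu
      refine ⟨|a| • γ, |a| * C, fun x hx => ?_⟩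
      rw [smul_dotProduct, smul_dotProduct, smul_eq_mul, smul_eq_mul, abs_mul, ← mul_sub]
      exact mul_le_mul_of_nonneg_left (h x hx) (abs_nonneg a)
  -- Each coordinate is controlled by some functional; adding these controls the norm.
  choose γ C h using fun j : Fin m => hP (Pi.single j 1) (hspan ▸ Submodule.mem_top)
  refine ⟨∑ j, γ j, ∑ j, C j, fun x hx => ?_⟩
  have h1 : ∑ j, |x j| ≤ ∑ j, (C j - dotProduct (γ j) x) :=
    Finset.sum_le_sum fun j _ => by simpa using h j x hx
  have h2 : ‖x‖ ≤ ∑ j, |x j| :=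
    (pi_norm_le_iff_of_nonneg (Finset.sum_nonneg fun _ _ => abs_nonneg _)).2 fun j =>
      Finset.single_le_sum (f := fun j => |x j|) (fun _ _ => abs_nonneg _) (Finset.mem_univ j)
  rw [Finset.sum_sub_distrib, ← sum_dotProduct] at h1
  linarith

/-- A large multiple `N b` of a separating functional is added to `s γ`, with `γ` decaying, and
rounded down. Rounding costs at most `m ‖x‖`, so `s = m + k + 1` leaves decay `(k + 1) ‖x‖`; `N` is
taken large enough to preserve separation at `q`. -/
theorem exists_int_separating {m : ℕ} {X : Set (Fin m → ℝ)} (hX : IsOpen X)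
    (hconv : Convex ℝ X) (hlin : linealitySpace X = ⊥) {q : Fin m → ℝ}
    (hq : q ∉ closure X) (k : ℕ) : ∃ (α : Fin m → ℤ) (C : ℝ),
      (∀ x ∈ X, ∑ j, (α j : ℝ) * x j ≤ C - (k + 1) * ‖x‖) ∧ C < ∑ j, (α j : ℝ) * q j := by
  obtain ⟨γ, C₀, hγ⟩ := exists_dotProduct_le_sub_norm hX hconv hlin
  obtain ⟨f, u, hfu, huq⟩ := geometric_hahn_banach_closed_point hconv.closure isClosed_closure hq
  obtain ⟨b, hb⟩ := exists_dotProduct_eq (f : (Fin m → ℝ) →ₗ[ℝ] ℝ)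
  have hbX : ∀ x ∈ X, dotProduct b x ≤ u := fun x hx => by
    rw [← hb x]; exact (hfu x (subset_closure hx)).le
  have hbq : 0 < dotProduct b q - u := by
    rw [← hb q]; exact sub_pos.2 huq
  set s : ℝ := m + k + 1 with hs
  have hs0 : 0 ≤ s := by positivity
  obtain ⟨N, hN⟩ := exists_nat_gt ((s * C₀ - s * dotProduct γ q + m * ‖q‖) / (dotProduct b q - u))
  rw [div_lt_iff₀ hbq] at hN
  set η : Fin m → ℝ := fun j => ⌊N * b j + s * γ j⌋ - (N * b j + s * γ j) with hη
  have hη1 : ∀ x : Fin m → ℝ, |dotProduct η x| ≤ m * ‖x‖ := by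
    intro x
    refine (Finset.abs_sum_le_sum_abs _ _).trans ?_
    calc ∑ j, |η j * x j| ≤ ∑ _j : Fin m, ‖x‖ := Finset.sum_le_sum fun j _ => by
          rw [abs_mul]
          have h1 : |η j| ≤ 1 := by
            rw [hη, abs_le]
            have h1 := Int.floor_le (N * b j + s * γ j)
            have h2 := Int.lt_floor_add_one (N * b j + s * γ j)
            constructor <;> simp only <;> linarith
          have h2 : |x j| ≤ ‖x‖ := norm_le_pi_norm x j
          calc |η j| * |x j| ≤ 1 * ‖x‖ := by gcongr
            _ = ‖x‖ := one_mul _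
      _ = m * ‖x‖ := by simp
  have hsum : ∀ x : Fin m → ℝ, ∑ j, ((⌊N * b j + s * γ j⌋ : ℤ) : ℝ) * x j =
      N * dotProduct b x + s * dotProduct γ x + dotProduct η x := by
    intro x
    simp only [dotProduct, Finset.mul_sum, ← Finset.sum_add_distrib, hη]
    exact Finset.sum_congr rfl fun j _ => by ring
  refine ⟨fun j => ⌊N * b j + s * γ j⌋, N * u + s * C₀, fun x hx => ?_, ?_⟩
  · rw [hsum]
    have h1 := mul_le_mul_of_nonneg_left (hγ x hx) hs0
    have h2 := mul_le_mul_of_nonneg_left (hbX x hx) (Nat.cast_nonneg (α := ℝ) N)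
    have h3 := (abs_le.1 (hη1 x)).2
    have h4 : s * ‖x‖ = m * ‖x‖ + (k + 1) * ‖x‖ := by rw [hs]; ring
    linarith
  · rw [hsum]
    have h3 := (abs_le.1 (hη1 q)).1
    linarith

/-! ### Calculus of functions with bounded, extendable derivatives -/

/-- `f` is holomorphic and bounded on `G` and extends continuously to the closure of `G`. -/
structure IsBoundedExtendable {n : ℕ} (G : Set (Fin n → ℂ)) (f : (Fin n → ℂ) → ℂ) : Prop where
  differentiableOn : DifferentiableOn ℂ f G
  exists_bound : ∃ M : ℝ, ∀ z ∈ G, ‖f z‖ ≤ M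
  exists_extension : ∃ g, ContinuousOn g (closure G) ∧ EqOn g f G

/-- All derivatives of `f` of order at most `k` are holomorphic, bounded and continuously extendable
to the closure of `G`. -/
def IsBoundedExtendableUpTo {n : ℕ} (G : Set (Fin n → ℂ)) : ℕ → ((Fin n → ℂ) → ℂ) → Prop
  | 0, f => IsBoundedExtendable G f
  | k + 1, f => IsBoundedExtendable G f ∧ ∀ j, IsBoundedExtendableUpTo G k (cpartial j f)

namespace IsBoundedExtendable

variable {n : ℕ} {G : Set (Fin n → ℂ)} {f g : (Fin n → ℂ) → ℂ}

theorem congr (hf : IsBoundedExtendable G f) (h : EqOn g f G) : IsBoundedExtendable G g := by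
  obtain ⟨hd, ⟨M, hM⟩, e, he, hef⟩ := hf
  exact ⟨hd.congr h, ⟨M, fun z hz => by rw [h hz]; exact hM z hz⟩, e, he, hef.trans h.symm⟩

theorem const (G : Set (Fin n → ℂ)) (c : ℂ) : IsBoundedExtendable G fun _ => c :=
  ⟨differentiableOn_const c, ⟨‖c‖, fun _ _ => le_rfl⟩, fun _ => c, continuousOn_const,
    fun _ _ => rfl⟩

theorem add (hf : IsBoundedExtendable G f) (hg : IsBoundedExtendable G g) :
    IsBoundedExtendable G fun z => f z + g z := by
  obtain ⟨hd, ⟨M, hM⟩, e, he, hef⟩ := hf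
  obtain ⟨hd', ⟨M', hM'⟩, e', he', hef'⟩ := hg
  refine ⟨hd.add hd', ⟨M + M', fun z hz => (norm_add_le _ _).trans
    (add_le_add (hM z hz) (hM' z hz))⟩, fun z => e z + e' z, he.add he', fun z hz => ?_⟩
  simp only [hef hz, hef' hz]

theorem mul (hf : IsBoundedExtendable G f) (hg : IsBoundedExtendable G g) :
    IsBoundedExtendable G fun z => f z * g z := by
  obtain ⟨hd, ⟨M, hM⟩, e, he, hef⟩ := hf
  obtain ⟨hd', ⟨M', hM'⟩, e', he', hef'⟩ := hg
  refine ⟨hd.mul hd', ⟨M * M', fun z hz => ?_⟩, fun z => e z * e' z, he.mul he', fun z hz => ?_⟩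
  · rw [norm_mul]
    exact mul_le_mul (hM z hz) (hM' z hz) (norm_nonneg _) ((norm_nonneg _).trans (hM z hz))
  · simp only [hef hz, hef' hz]

theorem inv (hf : IsBoundedExtendable G f) {δ : ℝ} (hδ : 0 < δ) (h : ∀ z ∈ G, δ ≤ ‖f z‖) :
    IsBoundedExtendable G fun z => (f z)⁻¹ := by
  obtain ⟨hd, -, e, he, hef⟩ := hf
  have hf0 : ∀ z ∈ G, f z ≠ 0 := fun z hz => norm_pos_iff.1 (hδ.trans_le (h z hz))
  have he0 : ∀ z ∈ closure G, e z ≠ 0 := fun z hz => by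
    refine norm_pos_iff.1 (hδ.trans_le ?_)
    exact ContinuousWithinAt.closure_le hz continuousWithinAt_const
      ((he z hz).norm.mono subset_closure) fun y hy => by rw [hef hy]; exact h y hy
  exact ⟨hd.inv hf0, ⟨δ⁻¹, fun z hz => by rw [norm_inv]; exact inv_anti₀ hδ (h z hz)⟩,
    fun z => (e z)⁻¹, he.inv₀ he0, fun z hz => by simp only [hef hz]⟩

theorem comp_coordProj {m : ℕ} {s : Fin m → Fin n} (hs : Function.Injective s)
    {D : Set (Fin m → ℂ)} {f : (Fin m → ℂ) → ℂ} (hf : IsBoundedExtendable D f) :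
    IsBoundedExtendable (coordProj s ⁻¹' D) fun z => f (coordProj s z) := by
  obtain ⟨hd, ⟨M, hM⟩, e, he, hef⟩ := hf
  refine ⟨hd.comp (coordProj s).differentiable.differentiableOn fun z hz => hz,
    ⟨M, fun z hz => hM _ hz⟩, fun z => e (coordProj s z), ?_, fun z hz => hef hz⟩
  rw [← (isOpenMap_coordProj hs).preimage_closure_eq_closure_preimage (coordProj s).continuous]
  exact he.comp (coordProj s).continuous.continuousOn fun z hz => hz

end IsBoundedExtendable

theorem cpartial_eqOn {n : ℕ} {G : Set (Fin n → ℂ)} (hG : IsOpen G) {f g : (Fin n → ℂ) → ℂ}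
    (h : EqOn f g G) (j : Fin n) : EqOn (cpartial j f) (cpartial j g) G := fun z hz => by
  unfold cpartial
  rw [Filter.EventuallyEq.fderiv_eq (Filter.eventuallyEq_of_mem (hG.mem_nhds hz) h)]

namespace IsBoundedExtendableUpTo

variable {n : ℕ} {G : Set (Fin n → ℂ)} {f g : (Fin n → ℂ) → ℂ}

theorem isBoundedExtendable : ∀ {k : ℕ}, IsBoundedExtendableUpTo G k f → IsBoundedExtendable G f
  | 0, h => h
  | _ + 1, h => h.1

theorem of_succ : ∀ {k : ℕ} {f : (Fin n → ℂ) → ℂ}, IsBoundedExtendableUpTo G (k + 1) f →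
    IsBoundedExtendableUpTo G k f
  | 0, _, h => h.1
  | _ + 1, _, h => ⟨h.1, fun j => of_succ (h.2 j)⟩

theorem congr (hG : IsOpen G) : ∀ {k : ℕ} {f g : (Fin n → ℂ) → ℂ},
    IsBoundedExtendableUpTo G k f → EqOn g f G → IsBoundedExtendableUpTo G k g
  | 0, _, _, hf, h => IsBoundedExtendable.congr hf h
  | _ + 1, _, _, hf, h => ⟨hf.1.congr h, fun j => congr hG (hf.2 j) (cpartial_eqOn hG h j)⟩

theorem const (G : Set (Fin n → ℂ)) : ∀ (k : ℕ) (c : ℂ), IsBoundedExtendableUpTo G k fun _ => c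
  | 0, c => IsBoundedExtendable.const G c
  | k + 1, c => ⟨IsBoundedExtendable.const G c, fun j => by
      have : cpartial j (fun _ : Fin n → ℂ => c) = fun _ => 0 := by
        ext z; simp [cpartial]
      rw [this]; exact const G k 0⟩

theorem add (hG : IsOpen G) : ∀ {k : ℕ} {f g : (Fin n → ℂ) → ℂ}, IsBoundedExtendableUpTo G k f →
    IsBoundedExtendableUpTo G k g → IsBoundedExtendableUpTo G k fun z => f z + g z
  | 0, _, _, hf, hg => IsBoundedExtendable.add hf hg
  | _ + 1, f, g, hf, hg => ⟨hf.1.add hg.1, fun j =>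
      congr hG (add hG (hf.2 j) (hg.2 j)) fun z hz => by
        unfold cpartial
        rw [fderiv_fun_add (hf.1.1.differentiableAt (hG.mem_nhds hz))
          (hg.1.1.differentiableAt (hG.mem_nhds hz))]
        rfl⟩

theorem mul (hG : IsOpen G) : ∀ {k : ℕ} {f g : (Fin n → ℂ) → ℂ}, IsBoundedExtendableUpTo G k f →
    IsBoundedExtendableUpTo G k g → IsBoundedExtendableUpTo G k fun z => f z * g z
  | 0, _, _, hf, hg => IsBoundedExtendable.mul hf hg
  | _ + 1, f, g, hf, hg => ⟨hf.1.mul hg.1, fun j =>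
      congr hG (add hG (mul hG hf.of_succ (hg.2 j)) (mul hG hg.of_succ (hf.2 j))) fun z hz => by
        unfold cpartial
        rw [fderiv_fun_mul (hf.1.1.differentiableAt (hG.mem_nhds hz))
          (hg.1.1.differentiableAt (hG.mem_nhds hz))]
        rfl⟩

theorem sum (hG : IsOpen G) {k : ℕ} {ι : Type*} (t : Finset ι) {F : ι → (Fin n → ℂ) → ℂ}
    (hF : ∀ i, IsBoundedExtendableUpTo G k (F i)) :
    IsBoundedExtendableUpTo G k fun z => ∑ i ∈ t, F i z := by
  classical
  induction t using Finset.induction_on with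
  | empty => simpa using const G k 0
  | insert i t hi ih => simpa [Finset.sum_insert hi] using add hG (hF i) ih

theorem inv (hG : IsOpen G) {δ : ℝ} (hδ : 0 < δ) : ∀ {k : ℕ} {f : (Fin n → ℂ) → ℂ},
    IsBoundedExtendableUpTo G k f → (∀ z ∈ G, δ ≤ ‖f z‖) →
      IsBoundedExtendableUpTo G k fun z => (f z)⁻¹
  | 0, _, hf, h => IsBoundedExtendable.inv hf hδ h
  | k + 1, f, hf, h => ⟨hf.1.inv hδ h, fun j => by
      have ih := inv hG hδ hf.of_succ h
      refine congr hG (mul hG (const G k (-1)) (mul hG (mul hG ih ih) (hf.2 j))) fun z hz => ?_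
      have hf0 : f z ≠ 0 := norm_pos_iff.1 (hδ.trans_le (h z hz))
      have h1 := (hf.1.1.differentiableAt (hG.mem_nhds hz)).hasFDerivAt
      have h2 := (hasDerivAt_inv hf0).comp_hasFDerivAt z h1
      unfold cpartial
      rw [HasFDerivAt.fderiv (f := fun z => (f z)⁻¹) h2]
      simp only [FunLike.coe_smul, Pi.smul_apply, smul_eq_mul]
      field_simp⟩

theorem comp_coordProj {m : ℕ} {s : Fin m → Fin n} (hs : Function.Injective s)
    {D : Set (Fin m → ℂ)} (hD : IsOpen D) : ∀ {k : ℕ} {f : (Fin m → ℂ) → ℂ},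
    IsBoundedExtendableUpTo D k f →
      IsBoundedExtendableUpTo (coordProj s ⁻¹' D) k fun z => f (coordProj s z)
  | 0, _, hf => IsBoundedExtendable.comp_coordProj hs hf
  | k + 1, f, hf => by
    have hG : IsOpen (coordProj s ⁻¹' D) := hD.preimage (coordProj s).continuous
    refine ⟨hf.1.comp_coordProj hs, fun j => congr hG (sum hG Finset.univ fun i =>
      mul hG (const _ k (coordProj s (Pi.single j 1) i)) (comp_coordProj hs hD (hf.2 i)))
        fun z hz => ?_⟩
    have h1 := (hf.1.1.differentiableAt (hD.mem_nhds hz)).hasFDerivAt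
    have h2 := h1.comp z (coordProj s).hasFDerivAt
    unfold cpartial
    rw [HasFDerivAt.fderiv (f := fun z => f (coordProj s z)) h2, ContinuousLinearMap.comp_apply]
    conv_lhs => rw [← Finset.univ_sum_single (coordProj s (Pi.single j 1))]
    rw [map_sum]
    refine Finset.sum_congr rfl fun i _ => ?_
    rw [← smul_eq_mul, ← map_smul]
    congr 1
    ext l
    by_cases h : l = i
    · subst h; simp
    · simp [h]

/-- Each partial derivative spends one unit of the order `k`; the induction over the coordinate list
carries the orders still available. -/
theorem multiPartial {k : ℕ} (hf : IsBoundedExtendableUpTo G k f) {ν : Fin n → ℕ}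
    (hν : ∑ j, ν j ≤ k) : IsBoundedExtendable G (multiPartial ν f) := by
  have hiter : ∀ (j : Fin n) (r l : ℕ) (h : (Fin n → ℂ) → ℂ), IsBoundedExtendableUpTo G (l + r) h →
      IsBoundedExtendableUpTo G l ((cpartial j)^[r] h) := by
    intro j r
    induction r with
    | zero => intro l h hh; exact hh
    | succ r ih =>
      intro l h hh
      rw [Function.iterate_succ_apply]
      exact ih l _ (hh.2 j)
  have hfold : ∀ (L : List (Fin n)) (l : ℕ), IsBoundedExtendableUpTo G (l + (L.map ν).sum) f →
      IsBoundedExtendableUpTo G l (L.foldr (fun j g => (cpartial j)^[ν j] g) f) := by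
    intro L
    induction L with
    | nil => intro l hl; simpa using hl
    | cons a L ih =>
      intro l hl
      rw [List.foldr_cons]
      refine hiter a (ν a) l _ (ih _ ?_)
      rwa [List.map_cons, List.sum_cons, ← add_assoc] at hl
  have hsum : ((List.finRange n).map ν).sum = ∑ j, ν j := by
    rw [← List.ofFn_eq_map, List.sum_ofFn]
  refine (hfold _ (k - ∑ j, ν j) ?_).isBoundedExtendable
  rwa [hsum, Nat.sub_add_cancel hν]

theorem mem_hInfty_inter_aSpace (hG : IsOpen G) {k : ℕ} (hf : IsBoundedExtendableUpTo G k f) :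
    f ∈ hInfty k G ∩ aSpace k G := by
  refine ⟨⟨hf.isBoundedExtendable.1, fun ν hν => ?_⟩, hf.isBoundedExtendable.1,
    fun ν hν => (hf.multiPartial hν).exists_extension⟩
  have h := hf.multiPartial hν
  obtain ⟨M, hM⟩ := h.exists_bound
  refine memLp_top_of_bound (h.1.continuousOn.aestronglyMeasurable hG.measurableSet) M ?_
  exact (ae_restrict_iff' hG.measurableSet).2 (Filter.Eventually.of_forall hM)

end IsBoundedExtendableUpTo

/-! ### Laurent monomials with decaying exponents -/

section DecayingMonomial

variable {m : ℕ} {D : Set (Fin m → ℂ)} {β : Fin m → ℤ} {C : ℝ}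

/-- Since `-‖x‖ ≤ x_j = log |z_j|`, the decay buys a factor `|z_j|`, which forces vanishing at the
hyperplanes. -/
theorem norm_laurentMonomial_le_of_decay (hc : IsNCircled D)
    (hβ : ∀ x ∈ logSet D, ∑ j, (β j : ℝ) * x j ≤ C - ‖x‖) {z : Fin m → ℂ}
    (hz : z ∈ D ∩ nonvanishing m) : ‖laurentMonomial β z‖ ≤ Real.exp C ∧
      ∀ j, ‖laurentMonomial β z‖ ≤ Real.exp C * ‖z j‖ := by
  rw [norm_laurentMonomial_eq_exp β hz.2]
  have h1 := hβ _ ((hc.logAbs_mem_iff hz.2).2 hz.1)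
  refine ⟨Real.exp_le_exp.2 (h1.trans (by linarith [norm_nonneg (logAbs z)])), fun j => ?_⟩
  rw [← Real.exp_log (norm_pos_iff.2 (hz.2 j)), ← Real.exp_add]
  refine Real.exp_le_exp.2 (h1.trans ?_)
  have h2 := norm_le_pi_norm (logAbs z) j
  rw [Real.norm_eq_abs] at h2
  have h3 := neg_abs_le (logAbs z j)
  simp only [logAbs] at h2 h3 ⊢
  linarith

theorem one_le_of_decay (hD : IsOpen D) (hc : IsNCircled D)
    (hβ : ∀ x ∈ logSet D, ∑ j, (β j : ℝ) * x j ≤ C - ‖x‖) {z : Fin m → ℂ} (hz : z ∈ D)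
    {j : Fin m} (hj : z j = 0) : 1 ≤ β j := by
  -- The factor `|w j|` in the bound can be divided out, so already the exponent lowered by one at
  -- `j` is nonnegative.
  have h := nonneg_of_norm_laurentMonomial_le (β := β - Pi.single j 1) (M := Real.exp C) hD hz hj
    fun w hw => by
      have h1 := (norm_laurentMonomial_le_of_decay hc hβ hw).2 j
      have hwj : 0 < ‖w j‖ := norm_pos_iff.2 (hw.2 j)
      have h2 : laurentMonomial β w = laurentMonomial (β - Pi.single j 1) w * w j := by
        simp only [laurentMonomial]
        rw [← Finset.mul_prod_erase _ _ (Finset.mem_univ j),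
          ← Finset.mul_prod_erase _ _ (Finset.mem_univ j), mul_right_comm]
        congr 1
        · rw [Pi.sub_apply, Pi.single_eq_same, zpow_sub_one₀ (hw.2 j),
            inv_mul_cancel_right₀ (hw.2 j)]
        · exact Finset.prod_congr rfl fun i hi => by simp [Finset.ne_of_mem_erase hi]
      rw [h2, norm_mul] at h1
      exact le_of_mul_le_mul_right h1 hwj
  simp only [Pi.sub_apply, Pi.single_eq_same] at h
  omega

theorem laurentMonomial_eq_zero_of_decay (hD : IsOpen D) (hc : IsNCircled D)
    (hβ : ∀ x ∈ logSet D, ∑ j, (β j : ℝ) * x j ≤ C - ‖x‖) {z : Fin m → ℂ} (hz : z ∈ D)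
    (hz0 : z ∉ nonvanishing m) : laurentMonomial β z = 0 := by
  simp only [nonvanishing, mem_ofPred_eq, not_forall, not_not] at hz0
  obtain ⟨j, hj⟩ := hz0
  have := one_le_of_decay hD hc hβ hz hj
  refine Finset.prod_eq_zero (Finset.mem_univ j) ?_
  rw [hj, zero_zpow _ (by omega)]

open Filter Topology in
theorem isBoundedExtendable_laurentMonomial (hD : IsOpen D) (hc : IsNCircled D)
    (hβ : ∀ x ∈ logSet D, ∑ j, (β j : ℝ) * x j ≤ C - ‖x‖) :
    IsBoundedExtendable D (laurentMonomial β) := by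
  classical
  have hdn : ∀ z ∈ nonvanishing m, DifferentiableAt ℂ (laurentMonomial β) z := fun z hz =>
    differentiableAt_laurentMonomial β fun j hj => absurd hj (hz j)
  refine ⟨fun z hz => (differentiableAt_laurentMonomial β fun j hj =>
    zero_le_one.trans (one_le_of_decay hD hc hβ hz hj)).differentiableWithinAt,
    ⟨Real.exp C, fun z hz => ?_⟩,
    fun z => if z ∈ nonvanishing m then laurentMonomial β z else 0, ?_, fun z hz => ?_⟩
  · by_cases hz0 : z ∈ nonvanishing m
    · exact (norm_laurentMonomial_le_of_decay hc hβ ⟨hz, hz0⟩).1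
    · rw [laurentMonomial_eq_zero_of_decay hD hc hβ hz hz0, norm_zero]
      positivity
  · intro p hp
    by_cases hp0 : p ∈ nonvanishing m
    · have hev : (fun z => if z ∈ nonvanishing m then laurentMonomial β z else 0) =ᶠ[𝓝 p]
          laurentMonomial β := by
        filter_upwards [(isOpen_nonvanishing m).mem_nhds hp0] with z hz
        rw [if_pos hz]
      exact ((hdn p hp0).continuousAt.congr hev.symm).continuousWithinAt
    · have hp1 := hp0
      simp only [nonvanishing, mem_ofPred_eq, not_forall, not_not] at hp1
      obtain ⟨j, hj⟩ := hp1
      -- The bound by `|z j|` passes to the closure, so the extension by zero tends to zero at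
      -- hyperplane points.
      have hle : ∀ z ∈ closure D, ‖if z ∈ nonvanishing m then laurentMonomial β z else 0‖ ≤
          Real.exp C * ‖z j‖ := by
        intro z hz
        by_cases hz0 : z ∈ nonvanishing m
        · rw [if_pos hz0]
          have h1 : z ∈ closure (nonvanishing m ∩ D) :=
            (isOpen_nonvanishing m).inter_closure ⟨hz0, hz⟩
          exact ContinuousWithinAt.closure_le h1 (hdn z hz0).continuousAt.norm.continuousWithinAt
            (Continuous.continuousWithinAt (by fun_prop)) fun y hy =>
              (norm_laurentMonomial_le_of_decay hc hβ ⟨hy.2, hy.1⟩).2 j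
        · rw [if_neg hz0, norm_zero]
          positivity
      unfold ContinuousWithinAt
      simp only [if_neg hp0]
      refine squeeze_zero_norm' (eventually_mem_nhdsWithin.mono hle) ?_
      have h2 : Tendsto (fun z : Fin m → ℂ => Real.exp C * ‖z j‖) (𝓝 p)
          (𝓝 (Real.exp C * ‖p j‖)) := Continuous.tendsto (by fun_prop) p
      rw [hj, norm_zero, mul_zero] at h2
      exact h2.mono_left nhdsWithin_le_nhds
  · show (if z ∈ nonvanishing m then laurentMonomial β z else 0) = laurentMonomial β z
    split_ifs with hz0
    · rfl
    · exact (laurentMonomial_eq_zero_of_decay hD hc hβ hz hz0).symm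

end DecayingMonomial

/-- Differentiating in `z_j` replaces `β` by `β - e_j` and raises the exponent by `-x_j ≤ ‖x‖`. Thus
`k` derivatives use `k ‖x‖` of the decay, and one `‖x‖` remains for continuity at the hyperplanes.
-/
theorem isBoundedExtendableUpTo_laurentMonomial {m : ℕ} {D : Set (Fin m → ℂ)} (hD : IsOpen D)
    (hc : IsNCircled D) : ∀ (k : ℕ) {β : Fin m → ℤ} {C : ℝ},
    (∀ x ∈ logSet D, ∑ j, (β j : ℝ) * x j ≤ C - (k + 1) * ‖x‖) →
      IsBoundedExtendableUpTo D k (laurentMonomial β)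
  | 0, β, C, hβ => isBoundedExtendable_laurentMonomial hD hc (C := C) (by simpa using hβ)
  | k + 1, β, C, hβ => by
    have hβ' : ∀ x ∈ logSet D, ∑ j, (β j : ℝ) * x j ≤ C - ‖x‖ := fun x hx => by
      have h1 := hβ x hx
      have h2 : 0 ≤ ((k : ℝ) + 1) * ‖x‖ := by positivity
      push_cast at h1
      linarith
    refine ⟨isBoundedExtendable_laurentMonomial hD hc hβ', fun j => ?_⟩
    have hk : IsBoundedExtendableUpTo D k (laurentMonomial (β - Pi.single j 1)) := by
      refine isBoundedExtendableUpTo_laurentMonomial hD hc k (C := C) fun x hx => ?_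
      have h1 := hβ x hx
      have h2 : ∑ i, (((β - Pi.single j 1 : Fin m → ℤ) i : ℤ) : ℝ) * x i =
          ∑ i, (β i : ℝ) * x i - x j := by
        have : ∀ i, (((β - Pi.single j 1 : Fin m → ℤ) i : ℤ) : ℝ) * x i =
            (β i : ℝ) * x i - (if i = j then x i else 0) := by
          intro i
          by_cases h : i = j
          · subst h; simp; ring
          · simp [h]
        rw [Finset.sum_congr rfl fun i _ => this i, Finset.sum_sub_distrib]
        simp
      have h3 := norm_le_pi_norm x j
      rw [Real.norm_eq_abs] at h3
      have h4 := neg_abs_le (x j)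
      rw [h2]
      push_cast at h1
      linarith
    exact ((IsBoundedExtendableUpTo.const D k (β j : ℂ)).mul hD hk).congr hD fun z hz =>
      cpartial_laurentMonomial β j fun i hi =>
        zero_le_one.trans (one_le_of_decay hD hc hβ' hz hi)

/-- Points of `log D` approximating `logAbs q`, exponentiated and rotated by the phases of `q`,
would approximate `q` from `D`. -/
theorem logAbs_notMem_closure_logSet {m : ℕ} {D : Set (Fin m → ℂ)} (hc : IsNCircled D)
    {q : Fin m → ℂ} (hq0 : q ∈ nonvanishing m) (hq : q ∉ closure D) :
    logAbs q ∉ closure (logSet D) := by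
  intro h
  set u : Fin m → ℂ := fun j => q j / ‖q j‖ with hu
  have hu1 : ∀ j, ‖u j‖ = 1 := fun j => by
    have : ‖q j‖ ≠ 0 := norm_ne_zero_iff.2 (hq0 j)
    simp [hu, this]
  have hcont : Continuous fun x => u * expPoint x := continuous_const.mul continuous_expPoint
  have h1 : u * expPoint (logAbs q) ∈ closure D :=
    hcont.continuousWithinAt.mem_closure h fun x hx => hc.mul_mem hu1 hx
  refine hq ?_
  convert! h1 using 1
  ext j
  have : (‖q j‖ : ℂ) ≠ 0 := by exact_mod_cast norm_ne_zero_iff.2 (hq0 j)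
  simp only [Pi.mul_apply, hu, expPoint, logAbs]
  rw [Real.exp_log (norm_pos_iff.2 (hq0 j)), div_mul_cancel₀ _ this]

theorem prod_pow_toNat_eq {m : ℕ} (α : Fin m → ℤ) {z : Fin m → ℂ} (hz : z ∈ nonvanishing m) :
    laurentMonomial α z * ∏ j, z j ^ (-α j).toNat = ∏ j, z j ^ (α j).toNat := by
  rw [laurentMonomial, ← Finset.prod_mul_distrib]
  refine Finset.prod_congr rfl fun j _ => ?_
  rw [← zpow_natCast, ← zpow_natCast, ← zpow_add₀ (hz j)]
  congr 1
  omega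

/-! ### The implication (i) to (iii) and the equivalence -/

theorem isDomainOfHolomorphyFor_of_isFatPointedTimesAffine {n : ℕ} {G : Set (Fin n → ℂ)}
    (hdom : IsCDomain G) (hG : IsFatPointedTimesAffine G) (k : ℕ) :
    IsDomainOfHolomorphyFor (hInfty k G ∩ aSpace k G) G := by
  obtain ⟨m, hm, σ, D, hfat, hc, hD, hlin, hGD⟩ := hG
  set s : Fin m → Fin n := fun i => σ (Fin.castLE hm i) with hs
  have hsi : Function.Injective s := σ.injective.comp (Fin.castLE_injective hm)
  replace hGD : G = coordProj s ⁻¹' D := hGD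
  have hDo : IsOpen D := hD.1.1
  have hcl : closure G = coordProj s ⁻¹' closure D := by
    rw [hGD, (isOpenMap_coordProj hsi).preimage_closure_eq_closure_preimage
      (coordProj s).continuous]
  have hGfat : interior (closure G) = G := by
    rw [hcl, ← (isOpenMap_coordProj hsi).preimage_interior_eq_interior_preimage
      (coordProj s).continuous, ← hfat, hGD]
  refine ⟨hdom, ?_⟩
  rintro ⟨G₀, G₁, h₀, h₁, hsub, hns, hext⟩
  -- If `G₁` lay in the closure of `G`, fatness would put it inside `G`.
  obtain ⟨q, ⟨hqG₁, hqG⟩, hq0⟩ :=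
    (dense_nonvanishing n).inter_open_nonempty (G₁ ∩ (closure G)ᶜ)
      (h₁.1.inter isClosed_closure.isOpen_compl) (by
        by_contra hempty
        rw [not_nonempty_iff_eq_empty, ← disjoint_iff_inter_eq_empty,
          disjoint_compl_right_iff_subset] at hempty
        exact hns (hGfat ▸ interior_maximal hempty h₁.1))
  have hπ0 : ∀ z ∈ nonvanishing n, coordProj s z ∈ nonvanishing m := fun z hz i => hz (s i)
  have hqD : coordProj s q ∉ closure D := fun h => hqG (hcl ▸ h)
  obtain ⟨α, C, hα, hCq⟩ := exists_int_separating (isOpen_logSet hDo) (convex_logSet hc hD) hlin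
    (logAbs_notMem_closure_logSet hc (hπ0 q hq0) hqD) k
  set c : ℂ := laurentMonomial α (coordProj s q) with hcdef
  have hcnorm : Real.exp C < ‖c‖ := by
    rw [hcdef, norm_laurentMonomial_eq_exp α (hπ0 q hq0)]
    exact Real.exp_lt_exp.2 hCq
  have hα' : ∀ x ∈ logSet D, ∑ j, (α j : ℝ) * x j ≤ C - ‖x‖ := fun x hx => by
    have h1 := hα x hx
    have h2 : 0 ≤ (k : ℝ) * ‖x‖ := by positivity
    linarith
  have hlow : ∀ z ∈ D, ‖c‖ - Real.exp C ≤ ‖c + -1 * laurentMonomial α z‖ := by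
    intro z hz
    have h1 : ‖laurentMonomial α z‖ ≤ Real.exp C := by
      by_cases hz0 : z ∈ nonvanishing m
      · exact (norm_laurentMonomial_le_of_decay hc hα' ⟨hz, hz0⟩).1
      · rw [laurentMonomial_eq_zero_of_decay hDo hc hα' hz hz0, norm_zero]
        positivity
    have h2 := norm_sub_norm_le c (laurentMonomial α z)
    rw [neg_one_mul, ← sub_eq_add_neg]
    linarith
  have hgood : IsBoundedExtendableUpTo D k fun z => (c + -1 * laurentMonomial α z)⁻¹ :=
    ((IsBoundedExtendableUpTo.const D k c).add hDo ((IsBoundedExtendableUpTo.const D k (-1)).mul hDo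
      (isBoundedExtendableUpTo_laurentMonomial hDo hc k hα))).inv hDo (sub_pos.2 hcnorm) hlow
  have hmem := (hgood.comp_coordProj hsi hDo).mem_hInfty_inter_aSpace
    (hDo.preimage (coordProj s).continuous)
  rw [← hGD] at hmem
  obtain ⟨g, hg, hgf⟩ := hext _ hmem
  have hgd : DifferentiableOn ℂ g G₁ := hg
  -- Off the hyperplanes the monomial is the quotient `P / Q` of polynomials. Clearing denominators
  -- in `g = 1 / (c - P / Q)` gives an identity valid on all of `G₁`; at `q` its left side vanishes
  -- while `Q q ≠ 0`.
  set P : (Fin n → ℂ) → ℂ := fun z => ∏ j, z (s j) ^ (α j).toNat with hP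
  set Q : (Fin n → ℂ) → ℂ := fun z => ∏ j, z (s j) ^ (-α j).toNat with hQ
  have hpoly : ∀ e : Fin m → ℕ, Differentiable ℂ fun z : Fin n → ℂ => ∏ j, z (s j) ^ e j := by
    intro e z
    classical
    exact (HasFDerivAt.finsetProd (u := Finset.univ) (g := fun j (z : Fin n → ℂ) => z (s j) ^ e j)
      fun j _ => DifferentiableAt.hasFDerivAt (by fun_prop)).differentiableAt
  have hPd : Differentiable ℂ P := hpoly _
  have hQd : Differentiable ℂ Q := hpoly _
  have hPQ : ∀ z ∈ nonvanishing n, laurentMonomial α (coordProj s z) * Q z = P z := fun z hz =>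
    prod_pow_toNat_eq α (hπ0 z hz)
  have heq : EqOn (fun z => g z * (c * Q z - P z)) Q G₁ := by
    refine eqOn_of_eqOn_open h₁.1 h₁.2.isPreconnected
      (hgd.mul ((hQd.const_mul c).sub hPd).differentiableOn) hQd.differentiableOn
      (h₀.1.inter (isOpen_nonvanishing n))
      ((dense_nonvanishing n).inter_open_nonempty _ h₀.1 h₀.2.nonempty)
      (fun z hz => (hsub hz.1).2) fun z hz => ?_
    have hzD : coordProj s z ∈ D := by
      have := (hsub hz.1).1
      rwa [hGD] at this
    have hne : c + -1 * laurentMonomial α (coordProj s z) ≠ 0 :=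
      norm_pos_iff.1 ((sub_pos.2 hcnorm).trans_le (hlow _ hzD))
    show g z * (c * Q z - P z) = Q z
    rw [hgf hz.1, ← hPQ z hz.2, inv_mul_eq_iff_eq_mul₀ hne]
    ring
  have hQq : Q q ≠ 0 := Finset.prod_ne_zero_iff.2 fun j _ => pow_ne_zero _ (hq0 (s j))
  have h1 := heq hqG₁
  simp only at h1
  rw [← hPQ q hq0, sub_self, mul_zero] at h1
  exact hQq h1.symm

theorem proposition7 {n : ℕ} (G : Set (Fin n → ℂ)) (hcirc : IsNCircled G)
    (hG : IsDomainOfHolomorphy G) :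
    List.TFAE [
      IsFatPointedTimesAffine G,
      IsDomainOfHolomorphyFor (hInfty 1 G) G,
      ∀ k : ℕ, IsDomainOfHolomorphyFor (hInfty k G ∩ aSpace k G) G] := by
  tfae_have 1 → 3 := isDomainOfHolomorphyFor_of_isFatPointedTimesAffine hG.1
  tfae_have 3 → 2 := fun h => (h 1).mono inter_subset_left
  tfae_have 2 → 1 := isFatPointedTimesAffine_of_hInfty_one hcirc hG
  tfae_finish
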